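/- Let $\mathcal{C}$ be a cartesian category (a category with finite limits), let $\mathbb{G}=(G_1\times_{G_0}G_1\xrightarrow{m}G_1\rightrightarrows G_0)$ be an internal groupoid in $\mathcal{C}$ with source $d_0$ and target $d_1$, and let $X$ be an object of $\mathcal{C}$. A $\mathbb{G}$-object is a morphism $g:A\to G_0$ with a unital, associative action $*:G_1\times_{G_0}A\to A$, where $k*a$ is defined when $d_0(k)=g(a)$, and $g(k*a)=d_1(k)$. With the morphisms over $G_0$ that commute with the actions, these form the category $[\mathbb{G},\mathcal{C}]$. The functor $\mathbb{G}^*:\mathcal{C}\to[\mathbb{G},\mathcal{C}]$ sends $Y$ to $\pi_1:G_0\times Y\to G_0$ with action $k*(d_0(k),y)=(d_1(k),y)$. A principal $\mathbb{G}$-bundle over $X$ is a $\mathbb{G}$-object $(P_g,*)$ together with a morphism $f:P\to X$ such that (i) $f(k*p)=f(p)$; (ii) $f$ is an effective descent morphism, i.e. the pullback functor $f^*:\mathcal{C}/X\to\mathcal{C}/P$ is monadic; (iii) $(*,\pi_2):G_1\times_{G_0}P\to P\times_XP$ is an isomorphism. Morphisms of principal $\mathbb{G}$-bundles over $X$ are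 the morphisms of $\mathbb{G}$-objects that commute with the morphisms to $X$. An adjunction $L\dashv R:\mathcal{D}\rightleftarrows\mathcal{E}$ between cartesian categories, with counit $\varepsilon$, satisfies Frobenius reciprocity if the canonical morphism $(\varepsilon_Y\circ L\pi_1,L\pi_2):L(RY\times W)\to Y\times LW$ is an isomorphism for all objects $Y$ of $\mathcal{E}$ and $W$ of $\mathcal{D}$. It is stably Frobenius if, for every object $Y$ of $\mathcal{E}$, the induced adjunction $L_Y\dashv R_Y:\mathcal{D}/RY\rightleftarrows\mathcal{E}/Y$ satisfies Frobenius reciprocity, where $L_Y$ sends $W\to RY$ to its adjoint transpose $LW\to Y$ and $R_Y$ is given by applying $R$. Suppose that $\mathbb{G}^*$ has a left adjoint $\Sigma_{\mathbb{G}}$ such that $\Sigma_{\mathbb{G}}\dashv\mathbb{G}^*$ is stably Frobenius. Then there is an equivalence between the category of principal $\mathbb{G}$-bundles over $X$ and the category of stably Frobenius adjunctions $L\dashv R:\mathcal{C}/X\rightleftarrows[\mathbb{G},\mathcal{C}]$ over $\mathcal{C}$. An object of the latter is a stably Frobenius adjunction $L\dashv R$ together with a natural isomorphism $\varphi:\Sigma_{\mathbb{G}}L\cong\Sigma_X$,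 where $\Sigma_X:\mathcal{C}/X\to\mathcal{C}$ is the functor $(Y\to X)\mapsto Y$; a morphism $(L,R,\varphi)\to(L',R',\varphi')$ is a natural transformation $\alpha:L\to L'$ over $\mathcal{C}$, i.e. one with $\varphi'\circ\Sigma_{\mathbb{G}}\alpha=\varphi$. -/

import Mathlib

open CategoryTheory CategoryTheory.Limits

universe v u v₁ u₁ v₂ u₂ v₃ u₃

noncomputable section

namespace FrobBundle

/-! ## Internal groupoids and their objects -/

section Groupoids

variable {C : Type u} [Category.{v} C] [HasPullbacks C]

attribute [local simp] pullback.lift_fst pullback.lift_snd pullback.lift_fst_assoc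
  pullback.lift_snd_assoc prod.lift_fst prod.lift_snd prod.lift_fst_assoc prod.lift_snd_assoc

variable (C) in
/-- An internal groupoid in `C`. An "element" `k` of `G₁` is an arrow with source `d₀ k` and
target `d₁ k`; the object `pullback d₀ d₁` consists of the composable pairs `(k, h)`
with `d₀ k = d₁ h`, and `m (k, h) = k ∘ h`. -/
structure InternalGroupoid where
  /-- the object of objects -/
  G₀ : C
  /-- the object of arrows -/
  G₁ : C
  /-- source -/
  d₀ : G₁ ⟶ G₀
  /-- target -/
  d₁ : G₁ ⟶ G₀
  /-- identities -/
  e : G₀ ⟶ G₁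
  /-- composition -/
  m : pullback d₀ d₁ ⟶ G₁
  /-- inverses -/
  i : G₁ ⟶ G₁
  e_d₀ : e ≫ d₀ = 𝟙 G₀
  e_d₁ : e ≫ d₁ = 𝟙 G₀
  m_d₀ : m ≫ d₀ = pullback.snd d₀ d₁ ≫ d₀
  m_d₁ : m ≫ d₁ = pullback.fst d₀ d₁ ≫ d₁
  i_d₀ : i ≫ d₀ = d₁
  i_d₁ : i ≫ d₁ = d₀
  one_m : pullback.lift (d₁ ≫ e) (𝟙 G₁) (by simp [e_d₀]) ≫ m = 𝟙 G₁
  m_one : pullback.lift (𝟙 G₁) (d₀ ≫ e) (by simp [e_d₁]) ≫ m = 𝟙 G₁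
  /-- associativity, on generalized elements -/
  m_assoc : ∀ {T : C} (k h l : T ⟶ G₁) (hkh : k ≫ d₀ = h ≫ d₁) (hhl : h ≫ d₀ = l ≫ d₁),
    pullback.lift (pullback.lift k h hkh ≫ m) l (by simp [m_d₀, hhl]) ≫ m =
      pullback.lift k (pullback.lift h l hhl ≫ m) (by simp [m_d₁, hkh]) ≫ m
  i_m : pullback.lift i (𝟙 G₁) (by simp [i_d₀]) ≫ m = d₀ ≫ e
  m_i : pullback.lift (𝟙 G₁) i (by simp [i_d₁]) ≫ m = d₁ ≫ e

variable (G : InternalGroupoid C)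

/-- A `G`-object `(A_g, *)`: an object `A` with a structure map `g : A ⟶ G₀` and an action
`G₁ ×_{G₀} A ⟶ A`, `(k, a) ↦ k * a`, defined when `d₀ k = g a`, with `g (k * a) = d₁ k`. -/
structure GObj where
  A : C
  g : A ⟶ G.G₀
  act : pullback G.d₀ g ⟶ A
  act_g : act ≫ g = pullback.fst G.d₀ g ≫ G.d₁
  one_act : pullback.lift (g ≫ G.e) (𝟙 A) (by simp [G.e_d₀]) ≫ act = 𝟙 A
  /-- `(k ∘ h) * a = k * (h * a)`, on generalized elements -/
  mul_act : ∀ {T : C} (k h : T ⟶ G.G₁) (a : T ⟶ A) (hkh : k ≫ G.d₀ = h ≫ G.d₁)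
    (hha : h ≫ G.d₀ = a ≫ g),
    pullback.lift (pullback.lift k h hkh ≫ G.m) a (by simp [G.m_d₀, hha]) ≫ act =
      pullback.lift k (pullback.lift h a hha ≫ act) (by simp [act_g, hkh]) ≫ act

variable {G} in
/-- A `G`-homomorphism: a morphism over `G₀` that commutes with the actions. -/
@[ext]
structure GObj.Hom (A B : GObj G) where
  hom : A.A ⟶ B.A
  hom_g : hom ≫ B.g = A.g
  act_hom : A.act ≫ hom =
    pullback.lift (pullback.fst G.d₀ A.g) (pullback.snd G.d₀ A.g ≫ hom)
      (by simp [hom_g, pullback.condition]) ≫ B.act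

/-- The category `[G, C]` of `G`-objects. -/
instance : Category (GObj G) where
  Hom A B := GObj.Hom A B
  id A :=
    { hom := 𝟙 A.A
      hom_g := by simp
      act_hom := by
        have : pullback.lift (pullback.fst G.d₀ A.g) (pullback.snd G.d₀ A.g ≫ 𝟙 A.A)
            (by simp [pullback.condition]) = 𝟙 _ := by
          apply pullback.hom_ext <;> simp
        rw [this]; simp }
  comp {A B D} f f' :=
    { hom := f.hom ≫ f'.hom
      hom_g := by simp [f.hom_g, f'.hom_g]
      act_hom := by
        rw [← Category.assoc, f.act_hom, Category.assoc, f'.act_hom, ← Category.assoc]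
        congr 1
        apply pullback.hom_ext <;> simp }
  id_comp f := GObj.Hom.ext (Category.id_comp _)
  comp_id f := GObj.Hom.ext (Category.comp_id _)
  assoc f f' f'' := GObj.Hom.ext (Category.assoc _ _ _)

variable {G}

@[ext]
lemma GObj.hom_ext {A B : GObj G} {f f' : A ⟶ B} (h : f.hom = f'.hom) : f = f' :=
  GObj.Hom.ext h

@[simp]
lemma GObj.id_hom (A : GObj G) : GObj.Hom.hom (𝟙 A) = 𝟙 A.A := rfl

@[simp]
lemma GObj.comp_hom {A B D : GObj G} (f : A ⟶ B) (f' : B ⟶ D) :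
    GObj.Hom.hom (f ≫ f') = f.hom ≫ f'.hom := rfl

/-- homomorphisms commute with the actions, on generalized elements -/
lemma GObj.lift_act_hom {A B : GObj G} (f : A ⟶ B) {T : C} (k : T ⟶ G.G₁) (a : T ⟶ A.A)
    (hka : k ≫ G.d₀ = a ≫ A.g) :
    pullback.lift k a hka ≫ A.act ≫ f.hom =
      pullback.lift k (a ≫ f.hom) (by rw [hka, Category.assoc, f.hom_g]) ≫ B.act := by
  rw [f.act_hom, ← Category.assoc]
  congr 1
  apply pullback.hom_ext <;> simp

/-- two morphisms into the domain of an action that agree become equal after acting -/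
lemma GObj.lift_act_congr {A : GObj G} {T : C} {k k' : T ⟶ G.G₁} {a a' : T ⟶ A.A}
    (hk : k = k') (ha : a = a') (hka : k ≫ G.d₀ = a ≫ A.g) (hka' : k' ≫ G.d₀ = a' ≫ A.g) :
    pullback.lift k a hka ≫ A.act = pullback.lift k' a' hka' ≫ A.act := by
  subst hk; subst ha; rfl

lemma GObj.comp_lift_act {A : GObj G} {S T : C} (t : S ⟶ T) (k : T ⟶ G.G₁) (a : T ⟶ A.A)
    (hka : k ≫ G.d₀ = a ≫ A.g) :
    t ≫ pullback.lift k a hka ≫ A.act =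
      pullback.lift (t ≫ k) (t ≫ a) (by rw [Category.assoc, hka, Category.assoc]) ≫ A.act := by
  rw [← Category.assoc]
  congr 1
  apply pullback.hom_ext <;> simp

/-! ### Pullbacks in `[G, C]`, created in `C` -/

section Pullbacks

variable {A B D : GObj G} (f : A ⟶ D) (f' : B ⟶ D)

lemma GObj.pb_g : pullback.snd f.hom f'.hom ≫ B.g = pullback.fst f.hom f'.hom ≫ A.g := by
  rw [← f.hom_g, ← f'.hom_g, pullback.condition_assoc]

/-- the componentwise action on the pullback of two homomorphisms -/
def GObj.pbAct :
    pullback G.d₀ (pullback.fst f.hom f'.hom ≫ A.g) ⟶ pullback f.hom f'.hom :=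
  pullback.lift
    (pullback.lift (pullback.fst _ _) (pullback.snd _ _ ≫ pullback.fst _ _)
      (by simp [pullback.condition]) ≫ A.act)
    (pullback.lift (pullback.fst _ _) (pullback.snd _ _ ≫ pullback.snd _ _)
      (by rw [Category.assoc, GObj.pb_g, pullback.condition]) ≫ B.act)
    (by
      refine (Category.assoc _ _ _).trans (Eq.trans ?_ (Category.assoc _ _ _).symm)
      refine (GObj.lift_act_hom _ _ _ _).trans (Eq.trans ?_ (GObj.lift_act_hom _ _ _ _).symm)
      apply GObj.lift_act_congr rfl
      simp [pullback.condition])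

lemma GObj.lift_pbAct_fst {T : C} (k : T ⟶ G.G₁) (p : T ⟶ pullback f.hom f'.hom)
    (h : k ≫ G.d₀ = p ≫ pullback.fst f.hom f'.hom ≫ A.g) :
    (pullback.lift k p h ≫ GObj.pbAct f f') ≫ pullback.fst f.hom f'.hom =
      pullback.lift k (p ≫ pullback.fst _ _) (by rw [h, Category.assoc]) ≫ A.act := by
  rw [Category.assoc, GObj.pbAct, pullback.lift_fst, GObj.comp_lift_act]
  apply GObj.lift_act_congr <;> simp

lemma GObj.lift_pbAct_snd {T : C} (k : T ⟶ G.G₁) (p : T ⟶ pullback f.hom f'.hom)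
    (h : k ≫ G.d₀ = p ≫ pullback.fst f.hom f'.hom ≫ A.g) :
    (pullback.lift k p h ≫ GObj.pbAct f f') ≫ pullback.snd f.hom f'.hom =
      pullback.lift k (p ≫ pullback.snd _ _)
        (by rw [h, Category.assoc, GObj.pb_g]) ≫ B.act := by
  rw [Category.assoc, GObj.pbAct, pullback.lift_snd, GObj.comp_lift_act]
  apply GObj.lift_act_congr <;> simp

lemma GObj.lift_one_act (A : GObj G) {T : C} (k : T ⟶ G.G₁) (a : T ⟶ A.A)
    (hk : k = (a ≫ A.g) ≫ G.e) (h : k ≫ G.d₀ = a ≫ A.g) :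
    pullback.lift k a h ≫ A.act = a := by
  subst hk
  refine Eq.trans ?_ (Category.comp_id a)
  rw [← A.one_act, GObj.comp_lift_act]
  apply GObj.lift_act_congr <;> simp

/-- the pullback of two homomorphisms, with the componentwise action -/
def GObj.pb : GObj G where
  A := pullback f.hom f'.hom
  g := pullback.fst f.hom f'.hom ≫ A.g
  act := GObj.pbAct f f'
  act_g := by
    rw [GObj.pbAct, pullback.lift_fst_assoc, Category.assoc, A.act_g, pullback.lift_fst_assoc]
  one_act := by
    apply pullback.hom_ext
    · rw [GObj.lift_pbAct_fst]
      refine (GObj.lift_one_act A _ _ ?_ _).trans rfl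
      simp
    · rw [GObj.lift_pbAct_snd]
      refine (GObj.lift_one_act B _ _ ?_ _).trans rfl
      simp [GObj.pb_g]
  mul_act {T} k h a hkh hha := by
    have hhb : h ≫ G.d₀ = (a ≫ pullback.snd _ _) ≫ B.g := by
      rw [hha, Category.assoc, GObj.pb_g]
    have hA := A.mul_act k h (a ≫ pullback.fst _ _) hkh (by rw [hha, Category.assoc])
    have hB := B.mul_act k h (a ≫ pullback.snd _ _) hkh hhb
    apply pullback.hom_ext
    · rw [GObj.lift_pbAct_fst, GObj.lift_pbAct_fst]
      refine hA.trans (GObj.lift_act_congr rfl ?_ _ _)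
      rw [GObj.lift_pbAct_fst]
    · rw [GObj.lift_pbAct_snd, GObj.lift_pbAct_snd]
      refine hB.trans (GObj.lift_act_congr rfl ?_ _ _)
      rw [GObj.lift_pbAct_snd]

def GObj.pbFst : GObj.pb f f' ⟶ A where
  hom := pullback.fst f.hom f'.hom
  hom_g := rfl
  act_hom := by simp [GObj.pb, GObj.pbAct]

def GObj.pbSnd : GObj.pb f f' ⟶ B where
  hom := pullback.snd f.hom f'.hom
  hom_g := GObj.pb_g f f'
  act_hom := by simp [GObj.pb, GObj.pbAct]

def GObj.pbLift {T : GObj G} (a : T ⟶ A) (b : T ⟶ B) (w : a ≫ f = b ≫ f') :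
    T ⟶ GObj.pb f f' where
  hom := pullback.lift a.hom b.hom (congrArg GObj.Hom.hom w)
  hom_g := by simp [GObj.pb, a.hom_g]
  act_hom := by
    apply pullback.hom_ext
    · refine Eq.trans ?_ (GObj.lift_pbAct_fst f f' _ _ _).symm
      refine (Category.assoc _ _ _).trans
        ((congrArg (T.act ≫ ·) (pullback.lift_fst _ _ _)).trans (a.act_hom.trans ?_))
      exact GObj.lift_act_congr rfl ((congrArg (pullback.snd G.d₀ T.g ≫ ·)
        (pullback.lift_fst _ _ _)).symm.trans (Category.assoc _ _ _).symm) _ _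
    · refine Eq.trans ?_ (GObj.lift_pbAct_snd f f' _ _ _).symm
      refine (Category.assoc _ _ _).trans
        ((congrArg (T.act ≫ ·) (pullback.lift_snd _ _ _)).trans (b.act_hom.trans ?_))
      exact GObj.lift_act_congr rfl ((congrArg (pullback.snd G.d₀ T.g ≫ ·)
        (pullback.lift_snd _ _ _)).symm.trans (Category.assoc _ _ _).symm) _ _

lemma GObj.isPullback_pb : IsPullback (GObj.pbFst f f') (GObj.pbSnd f f') f f' where
  w := GObj.hom_ext pullback.condition
  isLimit' := ⟨PullbackCone.IsLimit.mk _
    (fun s => GObj.pbLift f f' s.fst s.snd s.condition)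
    (fun _ => GObj.hom_ext (pullback.lift_fst _ _ _))
    (fun _ => GObj.hom_ext (pullback.lift_snd _ _ _))
    (fun _ _ h₁ h₂ => GObj.hom_ext (pullback.hom_ext
      ((congrArg GObj.Hom.hom h₁).trans (pullback.lift_fst _ _ _).symm)
      ((congrArg GObj.Hom.hom h₂).trans (pullback.lift_snd _ _ _).symm)))⟩

instance : HasPullbacks (GObj G) :=
  have : ∀ {A B D : GObj G} {f : A ⟶ D} {f' : B ⟶ D}, HasLimit (cospan f f') :=
    fun {_ _ _} {f} {f'} => (GObj.isPullback_pb f f').hasPullback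
  hasPullbacks_of_hasLimit_cospan _

end Pullbacks

variable (G) in
/-- The functor `G^* : C ⥤ [G, C]`, sending `X` to `(π₁ : G₀ × X ⟶ G₀, d₁ × Id_X)`. -/
def GStar [HasBinaryProducts C] : C ⥤ GObj G where
  obj X :=
    { A := G.G₀ ⨯ X
      g := prod.fst
      act := prod.lift (pullback.fst _ _ ≫ G.d₁) (pullback.snd _ _ ≫ prod.snd)
      act_g := by simp
      one_act := by apply Limits.prod.hom_ext <;> simp [G.e_d₁]
      mul_act := by
        intro T k h a hkh hha
        apply Limits.prod.hom_ext <;> simp [G.m_d₁] }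
  map f :=
    { hom := prod.map (𝟙 _) f
      hom_g := by simp
      act_hom := by apply Limits.prod.hom_ext <;> simp }
  map_id X := GObj.hom_ext (by simp)
  map_comp f f' := GObj.hom_ext (by simp)

/-! ## Principal bundles -/

/-- `f` is an effective descent morphism: the pullback functor `f^* : C/Y ⥤ C/X` is monadic. -/
def IsEffectiveDescent {X Y : C} (f : X ⟶ Y) : Prop :=
  Nonempty (MonadicRightAdjoint (Over.pullback f))

variable (G) in
/-- A principal `G`-bundle over `X`: a `G`-object `P` with a morphism `f : P ⟶ X` such that
`f (k * p) = f p`, `f` is an effective descent morphism and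
`(*, π₂) : G₁ ×_{G₀} P ⟶ P ×_X P` is an isomorphism. -/
structure PrincipalBundle (X : C) where
  P : GObj G
  f : P.A ⟶ X
  act_f : P.act ≫ f = pullback.snd G.d₀ P.g ≫ f
  descent : IsEffectiveDescent f
  isIso : IsIso (pullback.lift P.act (pullback.snd G.d₀ P.g) act_f :
    pullback G.d₀ P.g ⟶ pullback f f)

/-- A morphism of principal bundles over `X`: a `G`-homomorphism over `X`. -/
@[ext]
structure PrincipalBundle.Hom {X : C} (P Q : PrincipalBundle G X) where
  hom : P.P ⟶ Q.P
  hom_f : hom.hom ≫ Q.f = P.f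

/-- The category of principal `G`-bundles over `X`. -/
instance (X : C) : Category (PrincipalBundle G X) where
  Hom P Q := PrincipalBundle.Hom P Q
  id P := { hom := 𝟙 P.P, hom_f := by simp }
  comp φ ψ := { hom := φ.hom ≫ ψ.hom, hom_f := by simp [φ.hom_f, ψ.hom_f] }
  id_comp φ := PrincipalBundle.Hom.ext (Category.id_comp _)
  comp_id φ := PrincipalBundle.Hom.ext (Category.comp_id _)
  assoc φ ψ χ := PrincipalBundle.Hom.ext (Category.assoc _ _ _)

end Groupoids

/-! ## Frobenius adjunctions -/

section Frobenius

variable {D : Type u₁} [Category.{v₁} D] {E : Type u₂} [Category.{v₂} E]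

/-- `L ⊣ R : D ⇄ E` satisfies Frobenius reciprocity: for all `X` in `E` and `W` in `D`, the
canonical morphism `L (R X × W) ⟶ X × L W` is an isomorphism. -/
def SatisfiesFrobenius [HasBinaryProducts D] [HasBinaryProducts E] {L : D ⥤ E} {R : E ⥤ D}
    (adj : L ⊣ R) : Prop :=
  ∀ (X : E) (W : D),
    IsIso (prod.lift (L.map (prod.fst : R.obj X ⨯ W ⟶ R.obj X) ≫ adj.counit.app X)
      (L.map (prod.snd : R.obj X ⨯ W ⟶ W)))

instance {B : D} [HasPullbacks D] : HasBinaryProducts (Over B) :=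
  Over.ConstructProducts.over_binaryProduct_of_pullback

/-- `L ⊣ R : D ⇄ E` is stably Frobenius: for every `X` in `E` the adjunction
`L_X ⊣ R_X : D/RX ⇄ E/X` satisfies Frobenius reciprocity, where `L_X` sends `g : W ⟶ R X` to its
adjoint transpose `L W ⟶ X` and `R_X` sends `f` to `R f`. -/
def IsStablyFrobenius [HasPullbacks D] [HasPullbacks E] {L : D ⥤ E} {R : E ⥤ D}
    (adj : L ⊣ R) : Prop :=
  ∀ X : E, SatisfiesFrobenius (Over.postAdjunctionRight (Y := X) adj)

/-- A stably Frobenius adjunction `L ⊣ R : D ⇄ D'` over `C`, where `D` and `D'` are equipped with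
functors `S : D ⥤ C` and `S' : D' ⥤ C` (the left adjoints of their adjunctions with `C`): it
comes with a natural isomorphism `S' L ≅ S`. -/
structure StablyFrobeniusOver {C : Type u₃} [Category.{v₃} C] [HasPullbacks D] [HasPullbacks E]
    (S : D ⥤ C) (S' : E ⥤ C) where
  L : D ⥤ E
  R : E ⥤ D
  adj : L ⊣ R
  stablyFrobenius : IsStablyFrobenius adj
  isoOver : L ⋙ S' ≅ S

variable {C : Type u₃} [Category.{v₃} C] [HasPullbacks D] [HasPullbacks E]
  {S : D ⥤ C} {S' : E ⥤ C}

/-- A morphism of adjunctions over `C`: a natural transformation over `C` between the left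
adjoints. -/
@[ext]
structure StablyFrobeniusOver.Hom (F F' : StablyFrobeniusOver S S') where
  nat : F.L ⟶ F'.L
  w : Functor.whiskerRight nat S' ≫ F'.isoOver.hom = F.isoOver.hom

/-- The category of stably Frobenius adjunctions over `C`. -/
instance : Category (StablyFrobeniusOver S S') where
  Hom F F' := StablyFrobeniusOver.Hom F F'
  id F := { nat := 𝟙 F.L, w := by simp }
  comp α β :=
    { nat := α.nat ≫ β.nat
      w := by rw [Functor.whiskerRight_comp, Category.assoc, β.w, α.w] }
  id_comp α := StablyFrobeniusOver.Hom.ext (Category.id_comp _)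
  comp_id α := StablyFrobeniusOver.Hom.ext (Category.comp_id _)
  assoc α β γ := StablyFrobeniusOver.Hom.ext (Category.assoc _ _ _)

end Frobenius

end FrobBundle

end

noncomputable section

namespace FrobBundle

section Frobenius

variable {D : Type u₁} [Category.{v₁} D] {E : Type u₂} [Category.{v₂} E]

lemma isPullback_left_prod [HasPullbacks D] {B : D} (V W : Over B) :
    IsPullback (prod.fst : V ⨯ W ⟶ V).left (prod.snd : V ⨯ W ⟶ W).left V.hom W.hom :=
  Over.isPullback_of_binaryFan_isLimit (BinaryFan.mk prod.fst prod.snd) (prodIsProd V W)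

lemma isIso_prod_lift_iff_isPullback_left [HasPullbacks D] {B : D} {V W Z : Over B}
    (p : Z ⟶ V) (q : Z ⟶ W) :
    IsIso (prod.lift p q) ↔ IsPullback p.left q.left V.hom W.hom := by
  have hp : (prod.lift p q).left ≫ (prod.fst : V ⨯ W ⟶ V).left = p.left := by
    rw [← Over.comp_left, prod.lift_fst]
  have hq : (prod.lift p q).left ≫ (prod.snd : V ⨯ W ⟶ W).left = q.left := by
    rw [← Over.comp_left, prod.lift_snd]
  constructor
  · intro h
    have : IsIso (prod.lift p q).left :=
      inferInstanceAs (IsIso ((Over.forget B).map (prod.lift p q)))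
    exact (isPullback_left_prod V W).of_iso (asIso (prod.lift p q).left).symm (Iso.refl _)
      (Iso.refl _) (Iso.refl _) (by simp [hp]) (by simp [hq]) (by simp) (by simp)
  · intro h
    have e : (prod.lift p q).left = (h.isoIsPullback _ _ (isPullback_left_prod V W)).hom := by
      apply (isPullback_left_prod V W).hom_ext
      · rw [hp, IsPullback.isoIsPullback_hom_fst]
      · rw [hq, IsPullback.isoIsPullback_hom_snd]
    have : IsIso ((Over.forget B).map (prod.lift p q)) := by
      change IsIso (prod.lift p q).left
      rw [e]; infer_instance
    exact isIso_of_reflects_iso _ (Over.forget B)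

/-- Stable Frobenius reciprocity, as a condition on pullback squares. -/
lemma isStablyFrobenius_iff [HasPullbacks D] [HasPullbacks E] {L : D ⥤ E} {R : E ⥤ D}
    (adj : L ⊣ R) :
    IsStablyFrobenius adj ↔ ∀ ⦃V X : E⦄ ⦃W T : D⦄ (v : V ⟶ X) (w : W ⟶ R.obj X)
      (a : T ⟶ R.obj V) (b : T ⟶ W), IsPullback a b (R.map v) w →
        IsPullback (L.map a ≫ adj.counit.app V) (L.map b) v (L.map w ≫ adj.counit.app X) := by
  have key : ∀ (X : E) (V : Over X) (W : Over (R.obj X)),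
      IsIso (prod.lift
        ((Over.post L ⋙ Over.map (adj.counit.app X)).map
          (prod.fst : (Over.post R).obj V ⨯ W ⟶ (Over.post R).obj V) ≫
            (Over.postAdjunctionRight (Y := X) adj).counit.app V)
        ((Over.post L ⋙ Over.map (adj.counit.app X)).map
          (prod.snd : (Over.post R).obj V ⨯ W ⟶ W))) ↔
      IsPullback (L.map (prod.fst : (Over.post R).obj V ⨯ W ⟶ (Over.post R).obj V).left ≫
          adj.counit.app V.left)
        (L.map (prod.snd : (Over.post R).obj V ⨯ W ⟶ W).left) V.hom
        (L.map W.hom ≫ adj.counit.app X) := fun X V W =>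
    isIso_prod_lift_iff_isPullback_left _ _
  constructor
  · intro h V X W T v w a b sq
    have h1 := (key X (Over.mk v) (Over.mk w)).1 (h X (Over.mk v) (Over.mk w))
    have h2 := isPullback_left_prod ((Over.post R).obj (Over.mk v)) (Over.mk w)
    let e := sq.isoIsPullback _ _ h2
    have ea : L.map e.inv ≫ L.map a =
        L.map (prod.fst : (Over.post R).obj (Over.mk v) ⨯ _ ⟶ _).left :=
      (L.map_comp _ _).symm.trans (congrArg L.map (IsPullback.isoIsPullback_inv_fst _ _ sq h2))
    have eb : L.map e.inv ≫ L.map b =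
        L.map (prod.snd : (Over.post R).obj (Over.mk v) ⨯ _ ⟶ _).left :=
      (L.map_comp _ _).symm.trans (congrArg L.map (IsPullback.isoIsPullback_inv_snd _ _ sq h2))
    exact h1.of_iso (L.mapIso e.symm) (Iso.refl _) (Iso.refl _) (Iso.refl _)
      ((Category.comp_id _).trans ((congrArg (· ≫ adj.counit.app V) ea.symm).trans
        (Category.assoc _ _ _)))
      ((Category.comp_id _).trans eb.symm) (by simp) (by simp)
  · intro h X V W
    exact (key X V W).2 (h V.hom W.hom _ _ (isPullback_left_prod ((Over.post R).obj V) W))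

/-- An adjunction whose left adjoint preserves pullbacks and whose counit is cartesian is stably
Frobenius. -/
lemma isStablyFrobenius_of_counit_cartesian [HasPullbacks D] [HasPullbacks E]
    {L : D ⥤ E} {R : E ⥤ D} (adj : L ⊣ R) [PreservesLimitsOfShape WalkingCospan L]
    (h : ∀ ⦃V X : E⦄ (v : V ⟶ X),
      IsPullback (adj.counit.app V) (L.map (R.map v)) v (adj.counit.app X)) :
    IsStablyFrobenius adj := by
  rw [isStablyFrobenius_iff]
  intro V X W T v w a b sq
  exact (sq.map L).paste_horiz (h v)

end Frobenius

section Monads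

variable {D : Type u₁} [Category.{v₁} D] {E : Type u₂} [Category.{v₂} E]

/-- The monads of two adjunctions with the same right adjoint are isomorphic. -/
def toMonadIsoOfLeftAdjoints {L L' : D ⥤ E} {R : E ⥤ D} (adj : L ⊣ R) (adj' : L' ⊣ R) :
    adj.toMonad ≅ adj'.toMonad :=
  MonadIso.mk (Functor.isoWhiskerRight (adj.leftAdjointUniq adj') R)
    (fun X => adj.unit_leftAdjointUniq_hom_app adj' X)
    (fun X => by
      change R.map (adj.counit.app (L.obj X)) ≫ R.map ((adj.leftAdjointUniq adj').hom.app X) =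
        (R.map (L.map (R.map ((adj.leftAdjointUniq adj').hom.app X))) ≫
          R.map ((adj.leftAdjointUniq adj').hom.app (R.obj (L'.obj X)))) ≫
            R.map (adj'.counit.app (L'.obj X))
      rw [Category.assoc, ← R.map_comp, ← R.map_comp, ← R.map_comp,
        Adjunction.leftAdjointUniq_hom_app_counit]
      exact congrArg R.map (adj.counit_naturality _).symm)

lemma comparison_isEquivalence_of_leftAdjoints {L L' : D ⥤ E} {R : E ⥤ D} (adj : L ⊣ R)
    (adj' : L' ⊣ R) [(Monad.comparison adj).IsEquivalence] :
    (Monad.comparison adj').IsEquivalence := by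
  let e := Monad.algebraEquivOfIsoMonads (toMonadIsoOfLeftAdjoints adj adj')
  have i : Monad.comparison adj ⋙ e.functor ≅ Monad.comparison adj' :=
    NatIso.ofComponents (fun X => Monad.Algebra.isoMk (Iso.refl _) (by
      change R.map (L'.map (𝟙 (R.obj X))) ≫ R.map (adj'.counit.app X) =
        (R.map ((adj.leftAdjointUniq adj').inv.app (R.obj X)) ≫ R.map (adj.counit.app X)) ≫
          𝟙 (R.obj X)
      refine Eq.trans ?_ (Category.comp_id (R.map _ ≫ R.map _)).symm
      rw [L'.map_id, R.map_id, Category.id_comp, ← R.map_comp,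
        Adjunction.leftAdjointUniq_inv_app, Adjunction.leftAdjointUniq_hom_app_counit])) (fun f =>
      Monad.Algebra.Hom.ext ((Category.comp_id _).trans (Category.id_comp _).symm))
  exact Functor.isEquivalence_of_iso i

end Monads

section Elements

attribute [local simp] pullback.lift_fst pullback.lift_snd pullback.lift_fst_assoc
  pullback.lift_snd_assoc prod.lift_fst prod.lift_snd prod.lift_fst_assoc prod.lift_snd_assoc

variable {C : Type u} [Category.{v} C] [HasPullbacks C] {G : InternalGroupoid C}

/-- The composite `k ∘ h` of two generalized elements of `G₁`. -/
def InternalGroupoid.mul (G : InternalGroupoid C) {T : C} (k h : T ⟶ G.G₁)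
    (w : k ≫ G.d₀ = h ≫ G.d₁) : T ⟶ G.G₁ :=
  pullback.lift k h w ≫ G.m

lemma InternalGroupoid.mul_d₀ {T : C} (k h : T ⟶ G.G₁) (w : k ≫ G.d₀ = h ≫ G.d₁) :
    G.mul k h w ≫ G.d₀ = h ≫ G.d₀ := by
  rw [mul, Category.assoc, G.m_d₀, pullback.lift_snd_assoc]

lemma InternalGroupoid.mul_d₁ {T : C} (k h : T ⟶ G.G₁) (w : k ≫ G.d₀ = h ≫ G.d₁) :
    G.mul k h w ≫ G.d₁ = k ≫ G.d₁ := by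
  rw [mul, Category.assoc, G.m_d₁, pullback.lift_fst_assoc]

lemma InternalGroupoid.mul_congr {T : C} {k k' h h' : T ⟶ G.G₁} (hk : k = k') (hh : h = h')
    (w : k ≫ G.d₀ = h ≫ G.d₁) : G.mul k h w = G.mul k' h' (hk ▸ hh ▸ w) := by
  subst hk hh; rfl

lemma InternalGroupoid.mul_assoc {T : C} (k h l : T ⟶ G.G₁) (hkh : k ≫ G.d₀ = h ≫ G.d₁)
    (hhl : h ≫ G.d₀ = l ≫ G.d₁) :
    G.mul (G.mul k h hkh) l (by rw [mul_d₀, hhl]) =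
      G.mul k (G.mul h l hhl) (by rw [mul_d₁, hkh]) :=
  G.m_assoc k h l hkh hhl

lemma InternalGroupoid.comp_mul {S T : C} (t : S ⟶ T) (k h : T ⟶ G.G₁)
    (w : k ≫ G.d₀ = h ≫ G.d₁) :
    t ≫ G.mul k h w = G.mul (t ≫ k) (t ≫ h) (by rw [Category.assoc, w, Category.assoc]) := by
  rw [mul, mul, ← Category.assoc]
  congr 1
  apply pullback.hom_ext <;> simp

lemma InternalGroupoid.mul_one {T : C} (k : T ⟶ G.G₁) (w : k ≫ G.d₀ = ((k ≫ G.d₀) ≫ G.e) ≫ G.d₁) :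
    G.mul k ((k ≫ G.d₀) ≫ G.e) w = k := by
  refine Eq.trans ?_ ((congrArg (k ≫ ·) G.m_one).trans (Category.comp_id k))
  refine Eq.trans ?_ (Category.assoc _ _ _)
  rw [mul]
  congr 1
  apply pullback.hom_ext <;> simp

lemma InternalGroupoid.one_mul {T : C} (k : T ⟶ G.G₁) (w : ((k ≫ G.d₁) ≫ G.e) ≫ G.d₀ = k ≫ G.d₁) :
    G.mul ((k ≫ G.d₁) ≫ G.e) k w = k := by
  refine Eq.trans ?_ ((congrArg (k ≫ ·) G.one_m).trans (Category.comp_id k))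
  refine Eq.trans ?_ (Category.assoc _ _ _)
  rw [mul]
  congr 1
  apply pullback.hom_ext <;> simp

/-- The action `k * a` on generalized elements. -/
def GObj.ap (A : GObj G) {T : C} (k : T ⟶ G.G₁) (a : T ⟶ A.A) (w : k ≫ G.d₀ = a ≫ A.g) :
    T ⟶ A.A :=
  pullback.lift k a w ≫ A.act

namespace GObj

variable {A B : GObj G} {S T : C}

lemma act_eq_ap (A : GObj G) : A.act = A.ap (pullback.fst G.d₀ A.g) (pullback.snd G.d₀ A.g)
    pullback.condition := by
  rw [ap, show pullback.lift (pullback.fst G.d₀ A.g) (pullback.snd G.d₀ A.g)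
    pullback.condition = 𝟙 _ by apply pullback.hom_ext <;> simp, Category.id_comp]

lemma ap_congr {k k' : T ⟶ G.G₁} {a a' : T ⟶ A.A} (hk : k = k') (ha : a = a')
    (w : k ≫ G.d₀ = a ≫ A.g) :
    A.ap k a w = A.ap k' a' (hk ▸ ha ▸ w) := by
  subst hk ha; rfl

lemma comp_ap (t : S ⟶ T) (k : T ⟶ G.G₁) (a : T ⟶ A.A) (w : k ≫ G.d₀ = a ≫ A.g) :
    t ≫ A.ap k a w = A.ap (t ≫ k) (t ≫ a) (by rw [Category.assoc, w, Category.assoc]) :=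
  comp_lift_act _ _ _ _

lemma ap_g (k : T ⟶ G.G₁) (a : T ⟶ A.A) (w : k ≫ G.d₀ = a ≫ A.g) :
    A.ap k a w ≫ A.g = k ≫ G.d₁ := by
  rw [ap, Category.assoc, A.act_g, pullback.lift_fst_assoc]

lemma ap_hom (f : A ⟶ B) (k : T ⟶ G.G₁) (a : T ⟶ A.A) (w : k ≫ G.d₀ = a ≫ A.g) :
    A.ap k a w ≫ f.hom = B.ap k (a ≫ f.hom) (by rw [w, Category.assoc, f.hom_g]) := by
  rw [ap, Category.assoc]
  exact lift_act_hom f k a w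

lemma ap_one (k : T ⟶ G.G₁) (a : T ⟶ A.A) (w : k ≫ G.d₀ = a ≫ A.g)
    (hk : k = (a ≫ A.g) ≫ G.e) : A.ap k a w = a :=
  lift_one_act A k a hk w

lemma ap_mul (k h : T ⟶ G.G₁) (a : T ⟶ A.A) (hkh : k ≫ G.d₀ = h ≫ G.d₁)
    (hha : h ≫ G.d₀ = a ≫ A.g) :
    A.ap (G.mul k h hkh) a (by rw [InternalGroupoid.mul_d₀, hha]) =
      A.ap k (A.ap h a hha) (by rw [ap_g, hkh]) :=
  A.mul_act k h a hkh hha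

section

variable (A : C) (g : A ⟶ G.G₀)
  (ap : ∀ {T : C} (k : T ⟶ G.G₁) (a : T ⟶ A), k ≫ G.d₀ = a ≫ g → (T ⟶ A))
  (comp_ap : ∀ {S T : C} (t : S ⟶ T) (k : T ⟶ G.G₁) (a : T ⟶ A) (w : k ≫ G.d₀ = a ≫ g)
    (w' : (t ≫ k) ≫ G.d₀ = (t ≫ a) ≫ g), t ≫ ap k a w = ap (t ≫ k) (t ≫ a) w')
  (ap_g : ∀ {T : C} (k : T ⟶ G.G₁) (a : T ⟶ A) (w : k ≫ G.d₀ = a ≫ g), ap k a w ≫ g = k ≫ G.d₁)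
  (ap_one : ∀ {T : C} (a : T ⟶ A) (w : ((a ≫ g) ≫ G.e) ≫ G.d₀ = a ≫ g),
    ap ((a ≫ g) ≫ G.e) a w = a)
  (ap_mul : ∀ {T : C} (k h : T ⟶ G.G₁) (a : T ⟶ A) (hkh : k ≫ G.d₀ = h ≫ G.d₁)
    (hha : h ≫ G.d₀ = a ≫ g) (w : G.mul k h hkh ≫ G.d₀ = a ≫ g)
    (w' : k ≫ G.d₀ = ap h a hha ≫ g), ap (G.mul k h hkh) a w = ap k (ap h a hha) w')

/-- A `G`-object from an action on generalized elements. -/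
def ofAp : GObj G :=
  have congr : ∀ {T : C} {k k' : T ⟶ G.G₁} {a a' : T ⟶ A} (_ : k = k') (_ : a = a')
      (w : k ≫ G.d₀ = a ≫ g) (w' : k' ≫ G.d₀ = a' ≫ g), ap k a w = ap k' a' w' := by
    intro T k k' a a' hk ha w w'
    subst hk ha; rfl
  let act : pullback G.d₀ g ⟶ A := ap (pullback.fst _ _) (pullback.snd _ _) pullback.condition
  have lift_act : ∀ {T : C} (k : T ⟶ G.G₁) (a : T ⟶ A) (w : k ≫ G.d₀ = a ≫ g),
      pullback.lift k a w ≫ act = ap k a w := fun k a w =>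
    (comp_ap _ _ _ _ (by simp [w])).trans
      (congr (pullback.lift_fst _ _ _) (pullback.lift_snd _ _ _) _ _)
  { A := A
    g := g
    act := act
    act_g := ap_g _ _ _
    one_act := by
      rw [lift_act]
      exact (congr (by simp) rfl _ (by simp [G.e_d₀])).trans (ap_one (𝟙 A) _)
    mul_act k h a hkh hha := by
      rw [lift_act, lift_act]
      refine (ap_mul k h a hkh hha _ ?_).trans (congr rfl (lift_act _ _ _).symm _ _)
      rw [ap_g, hkh] }

end

/-- A morphism over `G₀` that commutes with the actions on generalized elements. -/
def homMk (u : A.A ⟶ B.A) (hg : u ≫ B.g = A.g)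
    (h : ∀ {T : C} (k : T ⟶ G.G₁) (a : T ⟶ A.A) (w : k ≫ G.d₀ = a ≫ A.g),
      A.ap k a w ≫ u = B.ap k (a ≫ u) (by rw [w, Category.assoc, hg])) : A ⟶ B where
  hom := u
  hom_g := hg
  act_hom := by
    conv_lhs => rw [act_eq_ap]
    exact h _ _ _

/-- The functor that forgets the action. -/
def forget (G : InternalGroupoid C) : GObj G ⥤ C where
  obj A := A.A
  map f := f.hom

instance : (forget G).ReflectsIsomorphisms where
  reflects {A B} f hf := by
    change IsIso f.hom at hf
    have hg : inv f.hom ≫ A.g = B.g := by rw [IsIso.inv_comp_eq, f.hom_g]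
    refine ⟨homMk (inv f.hom) hg ?_, GObj.hom_ext (IsIso.hom_inv_id f.hom),
      GObj.hom_ext (IsIso.inv_hom_id f.hom)⟩
    intro T k a w
    rw [IsIso.comp_inv_eq, ap_hom]
    exact ap_congr rfl (by simp) _

lemma isIso_of_isIso_hom (f : A ⟶ B) (h : IsIso f.hom) : IsIso f :=
  haveI : IsIso ((forget G).map f) := h
  isIso_of_reflects_iso f (forget G)

lemma isPullback_hom {X Y : GObj G} {a : X ⟶ A} {b : X ⟶ B} {c : A ⟶ Y} {d : B ⟶ Y}
    (h : IsPullback a b c d) : IsPullback a.hom b.hom c.hom d.hom := by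
  let e := h.isoIsPullback _ _ (isPullback_pb c d)
  have ha : e.hom ≫ pbFst c d = a := IsPullback.isoIsPullback_hom_fst _ _ _ _
  have hb : e.hom ≫ pbSnd c d = b := IsPullback.isoIsPullback_hom_snd _ _ _ _
  exact (IsPullback.of_hasPullback c.hom d.hom).of_iso ((forget G).mapIso e.symm) (Iso.refl _)
    (Iso.refl _) (Iso.refl _)
    ((Category.comp_id _).trans (congrArg GObj.Hom.hom (e.inv_comp_eq.2 ha.symm)).symm)
    ((Category.comp_id _).trans (congrArg GObj.Hom.hom (e.inv_comp_eq.2 hb.symm)).symm)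
    (by simp) (by simp)

end GObj

end Elements

section BundlePullback

attribute [local simp] pullback.lift_fst pullback.lift_snd pullback.lift_fst_assoc
  pullback.lift_snd_assoc prod.lift_fst prod.lift_snd prod.lift_fst_assoc prod.lift_snd_assoc

variable {C : Type u} [Category.{v} C] [HasPullbacks C] {G : InternalGroupoid C}

/-- A morphism out of a `G`-object that is constant on orbits. -/
def GObj.IsInvariant (P : GObj G) {X : C} (f : P.A ⟶ X) : Prop :=
  P.act ≫ f = pullback.snd G.d₀ P.g ≫ f

variable {P : GObj G} {X : C} {f : P.A ⟶ X}

lemma GObj.IsInvariant.ap (hf : P.IsInvariant f) {T : C} (k : T ⟶ G.G₁) (p : T ⟶ P.A)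
    (w : k ≫ G.d₀ = p ≫ P.g) : P.ap k p w ≫ f = p ≫ f := by
  rw [GObj.ap, Category.assoc, hf, pullback.lift_snd_assoc]

lemma GObj.IsInvariant.of_ap
    (h : ∀ {T : C} (k : T ⟶ G.G₁) (p : T ⟶ P.A) (w : k ≫ G.d₀ = p ≫ P.g),
      P.ap k p w ≫ f = p ≫ f) : P.IsInvariant f := by
  rw [GObj.IsInvariant, GObj.act_eq_ap]
  exact h _ _ _

lemma GObj.IsInvariant.hom_comp (hf : P.IsInvariant f) {Q : GObj G} (u : Q ⟶ P) :
    Q.IsInvariant (u.hom ≫ f) :=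
  .of_ap fun k q w => by
    rw [← Category.assoc, GObj.ap_hom, hf.ap, Category.assoc]

lemma GObj.IsInvariant.comp (hf : P.IsInvariant f) {Y : C} (u : X ⟶ Y) :
    P.IsInvariant (f ≫ u) := by
  have h : P.act ≫ f = pullback.snd G.d₀ P.g ≫ f := hf
  rw [GObj.IsInvariant, ← Category.assoc, h, Category.assoc]

/-- The `G`-object `W ×_X P` for a morphism `W ⟶ X`, with `G` acting on `P`. -/
def GObj.IsInvariant.pullbackObj (hf : P.IsInvariant f) (W : Over X) : GObj G where
  A := pullback W.hom f
  g := pullback.snd W.hom f ≫ P.g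
  act := pullback.lift (pullback.snd _ _ ≫ pullback.fst W.hom f)
    (P.ap (pullback.fst _ _) (pullback.snd _ _ ≫ pullback.snd W.hom f)
      (by rw [pullback.condition, Category.assoc]))
    (by rw [hf.ap, Category.assoc, Category.assoc, pullback.condition])
  act_g := by rw [pullback.lift_snd_assoc, GObj.ap_g]
  one_act := by
    apply pullback.hom_ext
    · simp
    · rw [Category.assoc, pullback.lift_snd, GObj.comp_ap]
      refine (GObj.ap_one _ _ _ ?_).trans ?_ <;> simp
  mul_act k h a hkh hha := by
    apply pullback.hom_ext
    · simp
    · simp only [Category.assoc, pullback.lift_snd, GObj.comp_ap]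
      refine (GObj.ap_congr (pullback.lift_fst _ _ _) (pullback.lift_snd_assoc _ _ _ _) _).trans
        ((GObj.ap_mul k h (a ≫ pullback.snd W.hom f) hkh (by rw [hha, Category.assoc])).trans
          (GObj.ap_congr (pullback.lift_fst _ _ _).symm ?_ _))
      refine Eq.trans ?_ (pullback.lift_snd_assoc _ _ _ _).symm
      refine Eq.trans ?_ (Category.assoc _ _ _).symm
      rw [pullback.lift_snd, GObj.comp_ap]
      exact GObj.ap_congr (pullback.lift_fst _ _ _).symm (pullback.lift_snd_assoc _ _ _ _).symm _

namespace GObj.IsInvariant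

variable (hf : P.IsInvariant f)

/-- The projection `W ×_X P ⟶ W`. -/
def pullbackFst (W : Over X) : (hf.pullbackObj W).A ⟶ W.left := pullback.fst W.hom f

lemma ap_pullbackFst (W : Over X) {T : C} (k : T ⟶ G.G₁) (a : T ⟶ (hf.pullbackObj W).A)
    (w : k ≫ G.d₀ = a ≫ (hf.pullbackObj W).g) :
    (hf.pullbackObj W).ap k a w ≫ hf.pullbackFst W = a ≫ hf.pullbackFst W :=
  (Category.assoc _ _ _).trans
    ((congrArg (pullback.lift k a w ≫ ·) (pullback.lift_fst _ _ _)).trans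
      (pullback.lift_snd_assoc _ _ _ _))

/-- The equivariant projection `W ×_X P ⟶ P`. -/
def pullbackSnd (W : Over X) : hf.pullbackObj W ⟶ P :=
  homMk (pullback.snd W.hom f) rfl fun k a w =>
    (Category.assoc _ _ _).trans
      ((congrArg (pullback.lift k a w ≫ ·) (pullback.lift_snd _ _ _)).trans
        ((comp_ap _ _ _ _).trans
          (ap_congr (pullback.lift_fst _ _ _) (pullback.lift_snd_assoc _ _ _ _) _)))

lemma isInvariant_pullbackFst (W : Over X) : (hf.pullbackObj W).IsInvariant (hf.pullbackFst W) :=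
  .of_ap fun k a w => hf.ap_pullbackFst W k a w

lemma isPullback (W : Over X) :
    IsPullback (hf.pullbackFst W) (hf.pullbackSnd W).hom W.hom f :=
  IsPullback.of_hasPullback _ _

/-- A morphism into `W ×_X P` given by its components. -/
def pullbackLift (W : Over X) {Q : GObj G} (a : Q.A ⟶ W.left) (ha : Q.IsInvariant a)
    (b : Q ⟶ P) (w : a ≫ W.hom = b.hom ≫ f) : Q ⟶ hf.pullbackObj W :=
  homMk ((hf.isPullback W).lift a b.hom w)
    (by rw [← (hf.pullbackSnd W).hom_g, IsPullback.lift_snd_assoc, b.hom_g])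
    fun k q wq => by
      apply (hf.isPullback W).hom_ext
      · rw [ap_pullbackFst, Category.assoc, Category.assoc, IsPullback.lift_fst, ha.ap]
      · rw [ap_hom, Category.assoc, IsPullback.lift_snd, ap_hom]
        exact ap_congr rfl (by rw [Category.assoc, IsPullback.lift_snd]) _

@[simp]
lemma pullbackLift_fst (W : Over X) {Q : GObj G} (a : Q.A ⟶ W.left) (ha : Q.IsInvariant a)
    (b : Q ⟶ P) (w : a ≫ W.hom = b.hom ≫ f) :
    (hf.pullbackLift W a ha b w).hom ≫ hf.pullbackFst W = a :=
  IsPullback.lift_fst _ _ _ _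

@[simp]
lemma pullbackLift_snd (W : Over X) {Q : GObj G} (a : Q.A ⟶ W.left) (ha : Q.IsInvariant a)
    (b : Q ⟶ P) (w : a ≫ W.hom = b.hom ≫ f) :
    hf.pullbackLift W a ha b w ≫ hf.pullbackSnd W = b :=
  GObj.hom_ext (IsPullback.lift_snd _ _ _ _)

@[simp]
lemma pullbackLift_fst_assoc (W : Over X) {Q : GObj G} (a : Q.A ⟶ W.left) (ha : Q.IsInvariant a)
    (b : Q ⟶ P) (w : a ≫ W.hom = b.hom ≫ f) {Z : C} (h : W.left ⟶ Z) :
    (hf.pullbackLift W a ha b w).hom ≫ hf.pullbackFst W ≫ h = a ≫ h := by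
  rw [← Category.assoc, pullbackLift_fst]

lemma pullbackObj_hom_ext {W : Over X} {Q : GObj G} {u u' : Q ⟶ hf.pullbackObj W}
    (h₁ : u.hom ≫ hf.pullbackFst W = u'.hom ≫ hf.pullbackFst W)
    (h₂ : u ≫ hf.pullbackSnd W = u' ≫ hf.pullbackSnd W) : u = u' :=
  GObj.hom_ext ((hf.isPullback W).hom_ext h₁ (congrArg GObj.Hom.hom h₂))

/-- The morphism `W ×_X P ⟶ W' ×_X P` induced by a morphism over `X`. -/
def pullbackMap {W W' : Over X} (s : W ⟶ W') : hf.pullbackObj W ⟶ hf.pullbackObj W' :=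
  hf.pullbackLift W' (hf.pullbackFst W ≫ s.left) ((hf.isInvariant_pullbackFst W).comp s.left)
    (hf.pullbackSnd W) (by rw [Category.assoc, Over.w s, (hf.isPullback W).w])

@[simp]
lemma pullbackMap_fst {W W' : Over X} (s : W ⟶ W') :
    (hf.pullbackMap s).hom ≫ hf.pullbackFst W' = hf.pullbackFst W ≫ s.left :=
  hf.pullbackLift_fst _ _ _ _ _

@[simp]
lemma pullbackMap_snd {W W' : Over X} (s : W ⟶ W') :
    hf.pullbackMap s ≫ hf.pullbackSnd W' = hf.pullbackSnd W :=
  hf.pullbackLift_snd _ _ _ _ _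

@[simp]
lemma pullbackMap_fst_assoc {W W' : Over X} (s : W ⟶ W') {Z : C} (h : W'.left ⟶ Z) :
    (hf.pullbackMap s).hom ≫ hf.pullbackFst W' ≫ h = hf.pullbackFst W ≫ s.left ≫ h := by
  rw [← Category.assoc, pullbackMap_fst, Category.assoc]

@[simp]
lemma pullbackMap_snd_assoc {W W' : Over X} (s : W ⟶ W') {Z : GObj G} (h : P ⟶ Z) :
    hf.pullbackMap s ≫ hf.pullbackSnd W' ≫ h = hf.pullbackSnd W ≫ h := by
  rw [← Category.assoc, pullbackMap_snd]

/-- The functor `W ↦ W ×_X P` from `C/X` to `G`-objects over `P`. -/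
def toOver : Over X ⥤ Over P where
  obj W := Over.mk (hf.pullbackSnd W)
  map s := Over.homMk (hf.pullbackMap s) (hf.pullbackMap_snd s)
  map_id W := Over.OverMorphism.ext (hf.pullbackObj_hom_ext (by simp) (by simp))
  map_comp s t := Over.OverMorphism.ext (hf.pullbackObj_hom_ext (by simp) (by simp))

end GObj.IsInvariant

end BundlePullback

section Torsor

attribute [local simp] pullback.lift_fst pullback.lift_snd pullback.lift_fst_assoc
  pullback.lift_snd_assoc prod.lift_fst prod.lift_snd prod.lift_fst_assoc prod.lift_snd_assoc

variable {C : Type u} [Category.{v} C] [HasPullbacks C] {G : InternalGroupoid C}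

namespace GObj

/-- The free `G`-object `{(k, p) | d₀ k = g p}` on the structure map of `P`, with
`h * (k, p) = (h ∘ k, p)`. -/
def free (P : GObj G) : GObj G where
  A := pullback G.d₀ P.g
  g := pullback.fst G.d₀ P.g ≫ G.d₁
  act := pullback.lift
    (G.mul (pullback.fst _ _) (pullback.snd _ _ ≫ pullback.fst _ _)
      (by rw [pullback.condition, Category.assoc]))
    (pullback.snd _ _ ≫ pullback.snd _ _)
    (by rw [InternalGroupoid.mul_d₀, Category.assoc, pullback.condition, Category.assoc])
  act_g := by rw [pullback.lift_fst_assoc, InternalGroupoid.mul_d₁]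
  one_act := by
    apply pullback.hom_ext
    · refine ((Category.assoc _ _ _).trans ((congrArg (_ ≫ ·) (pullback.lift_fst _ _ _)).trans
        (InternalGroupoid.comp_mul _ _ _ _))).trans ?_
      refine (InternalGroupoid.mul_congr (pullback.lift_fst _ _ _)
        ((pullback.lift_snd_assoc _ _ _ _).trans (Category.id_comp _)) _).trans ?_
      rw [InternalGroupoid.one_mul, Category.id_comp]
    · simp
  mul_act k h a hkh hha := by
    apply pullback.hom_ext
    · refine ((Category.assoc _ _ _).trans ((congrArg (_ ≫ ·) (pullback.lift_fst _ _ _)).trans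
        (InternalGroupoid.comp_mul _ _ _ _))).trans (Eq.trans ?_ ((Category.assoc _ _ _).trans
          ((congrArg (_ ≫ ·) (pullback.lift_fst _ _ _)).trans
            (InternalGroupoid.comp_mul _ _ _ _))).symm)
      refine (InternalGroupoid.mul_congr (pullback.lift_fst _ _ _) (pullback.lift_snd_assoc _ _ _ _)
        _).trans ((InternalGroupoid.mul_assoc k h (a ≫ pullback.fst _ _) hkh
          (by rw [hha, Category.assoc])).trans
            (InternalGroupoid.mul_congr (pullback.lift_fst _ _ _).symm ?_ _))
      refine Eq.trans ?_ ((pullback.lift_snd_assoc _ _ _ _).trans ((Category.assoc _ _ _).trans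
        ((congrArg (_ ≫ ·) (pullback.lift_fst _ _ _)).trans
          (InternalGroupoid.comp_mul _ _ _ _)))).symm
      exact InternalGroupoid.mul_congr (pullback.lift_fst _ _ _).symm
        (pullback.lift_snd_assoc _ _ _ _).symm _
    · simp

variable (P : GObj G)

/-- The first component of an element of the free `G`-object. -/
def freeFst : P.free.A ⟶ G.G₁ := pullback.fst G.d₀ P.g

/-- The second component of an element of the free `G`-object. -/
def freeSnd : P.free.A ⟶ P.A := pullback.snd G.d₀ P.g

lemma isPullback_free : IsPullback P.freeFst P.freeSnd G.d₀ P.g :=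
  IsPullback.of_hasPullback _ _

lemma free_g : P.free.g = P.freeFst ≫ G.d₁ := rfl

lemma free_ap_fst {T : C} (k : T ⟶ G.G₁) (a : T ⟶ P.free.A) (w : k ≫ G.d₀ = a ≫ P.free.g) :
    P.free.ap k a w ≫ P.freeFst =
      G.mul k (a ≫ P.freeFst) (by rw [w, free_g, Category.assoc]) := by
  refine (Category.assoc _ _ _).trans
    ((congrArg (pullback.lift k a w ≫ ·) (pullback.lift_fst _ _ _)).trans ?_)
  exact (InternalGroupoid.comp_mul _ _ _ _).trans
    (InternalGroupoid.mul_congr (pullback.lift_fst _ _ _) (pullback.lift_snd_assoc _ _ _ _) _)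

lemma free_ap_snd {T : C} (k : T ⟶ G.G₁) (a : T ⟶ P.free.A) (w : k ≫ G.d₀ = a ≫ P.free.g) :
    P.free.ap k a w ≫ P.freeSnd = a ≫ P.freeSnd :=
  (Category.assoc _ _ _).trans
    ((congrArg (pullback.lift k a w ≫ ·) (pullback.lift_snd _ _ _)).trans
      (pullback.lift_snd_assoc _ _ _ _))

lemma isInvariant_freeSnd : P.free.IsInvariant P.freeSnd :=
  .of_ap fun k a w => P.free_ap_snd k a w

/-- The action as an equivariant morphism from the free `G`-object. -/
def freeAct : P.free ⟶ P :=
  homMk (P.ap P.freeFst P.freeSnd P.isPullback_free.w) (P.ap_g _ _ _) fun k a w => by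
    have w' : (a ≫ P.freeFst) ≫ G.d₀ = (a ≫ P.freeSnd) ≫ P.g := by
      rw [Category.assoc, P.isPullback_free.w, Category.assoc]
    refine (comp_ap _ _ _ _).trans ((ap_congr (P.free_ap_fst k a w) (P.free_ap_snd k a w) _).trans
      ((ap_mul k _ _ _ w').trans (ap_congr rfl (comp_ap _ _ _ _).symm _)))

lemma freeAct_hom : P.freeAct.hom = P.act := P.act_eq_ap.symm

/-- The unit `p ↦ (1, p)` of the free `G`-object. -/
def freeUnit : P.A ⟶ P.free.A :=
  P.isPullback_free.lift (P.g ≫ G.e) (𝟙 P.A) (by simp [G.e_d₀])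

lemma freeUnit_act : P.freeUnit ≫ P.freeAct.hom = 𝟙 P.A := by
  refine (comp_ap _ _ _ _).trans ((ap_one _ _ _ ?_).trans (IsPullback.lift_snd _ _ _ _))
  rw [freeUnit, IsPullback.lift_fst, IsPullback.lift_snd, Category.id_comp]

lemma freeUnit_snd : P.freeUnit ≫ P.freeSnd = 𝟙 P.A := IsPullback.lift_snd _ _ _ _

lemma freeSnd_unit_comp {Y : C} (c : P.free.A ⟶ Y) (hc : P.free.IsInvariant c) :
    P.freeSnd ≫ P.freeUnit ≫ c = c := by
  have w : P.freeFst ≫ G.d₀ = (P.freeSnd ≫ P.freeUnit) ≫ P.free.g := by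
    rw [free_g, P.isPullback_free.w, Category.assoc, freeUnit, IsPullback.lift_fst_assoc,
      Category.assoc, G.e_d₁, Category.comp_id]
  have h : P.free.ap P.freeFst (P.freeSnd ≫ P.freeUnit) w = 𝟙 _ := by
    apply P.isPullback_free.hom_ext
    · rw [free_ap_fst]
      have e : (P.freeSnd ≫ P.freeUnit) ≫ P.freeFst = (P.freeFst ≫ G.d₀) ≫ G.e := by
        rw [Category.assoc, freeUnit, IsPullback.lift_fst, P.isPullback_free.w, Category.assoc]
      simp only [e]
      rw [InternalGroupoid.mul_one, Category.id_comp]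
    · rw [free_ap_snd, Category.assoc, freeUnit_snd, Category.comp_id, Category.id_comp]
  have := hc.ap P.freeFst (P.freeSnd ≫ P.freeUnit) w
  rw [h, Category.id_comp, Category.assoc] at this
  exact this.symm

/-- If `W ↦ W ×_X P` is an equivalence from `C/X` to the `G`-objects over `P`, then
`(*, π₂) : G₁ ×_{G₀} P ⟶ P ×_X P` is an isomorphism. -/
lemma IsInvariant.isPullback_act {P : GObj G} {X : C} {f : P.A ⟶ X} (hf : P.IsInvariant f)
    [hf.toOver.IsEquivalence] :
    IsPullback P.act (pullback.snd G.d₀ P.g) f f := by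
  have hw : P.freeSnd ≫ f = P.freeAct.hom ≫ f := by
    rw [freeAct_hom]; exact hf.symm
  let Q : Over P := Over.mk P.freeAct
  let F : Over X := Over.mk f
  let u : Q ⟶ hf.toOver.obj F :=
    Over.homMk (hf.pullbackLift F P.freeSnd P.isInvariant_freeSnd P.freeAct hw)
      (hf.pullbackLift_snd _ _ _ _ _)
  have hu : ∀ {W : Over X} (θ : Q ⟶ hf.toOver.obj W), ∃ t : F ⟶ W, θ = u ≫ hf.toOver.map t := by
    intro W θ
    let θ' : P.free ⟶ hf.pullbackObj W := θ.left
    have hθ : θ' ≫ hf.pullbackSnd W = P.freeAct := Over.w θ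
    have hθ' : θ'.hom ≫ (hf.pullbackSnd W).hom = P.freeAct.hom := congrArg GObj.Hom.hom hθ
    have hc : P.free.IsInvariant (θ'.hom ≫ hf.pullbackFst W) :=
      (hf.isInvariant_pullbackFst W).hom_comp θ'
    refine ⟨Over.homMk (P.freeUnit ≫ θ'.hom ≫ hf.pullbackFst W) ?_, ?_⟩
    · change _ = f
      rw [Category.assoc, Category.assoc, (hf.isPullback W).w, ← Category.assoc θ'.hom, hθ',
        ← Category.assoc, freeUnit_act]
      exact Category.id_comp f
    · apply Over.OverMorphism.ext
      refine hf.pullbackObj_hom_ext (u := θ') ?_ ?_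
      · refine Eq.trans ?_ (Category.assoc _ _ _).symm
        refine Eq.trans ?_ (congrArg (_ ≫ ·) (hf.pullbackMap_fst _).symm)
        refine Eq.trans ?_ (hf.pullbackLift_fst_assoc _ _ P.isInvariant_freeSnd _ _ _).symm
        exact (P.freeSnd_unit_comp _ hc).symm
      · refine hθ.trans (Eq.trans ?_ (Category.assoc _ _ _).symm)
        refine Eq.trans ?_ (congrArg (_ ≫ ·) (hf.pullbackMap_snd _).symm)
        exact (hf.pullbackLift_snd _ _ P.isInvariant_freeSnd _ _).symm
  have hu' : ∀ {W : Over X} (t t' : F ⟶ W), u ≫ hf.toOver.map t = u ≫ hf.toOver.map t' →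
      t = t' := by
    intro W t t' h
    have key : ∀ s : F ⟶ W, P.freeUnit ≫ ((u ≫ hf.toOver.map s).left).hom ≫ hf.pullbackFst W =
        s.left := by
      intro s
      have h1 : ((u ≫ hf.toOver.map s).left).hom ≫ hf.pullbackFst W = P.freeSnd ≫ s.left := by
        refine (Category.assoc _ _ _).trans ?_
        refine (congrArg (_ ≫ ·) (hf.pullbackMap_fst _)).trans ?_
        exact hf.pullbackLift_fst_assoc _ _ P.isInvariant_freeSnd _ _ _
      refine (congrArg (_ ≫ ·) h1).trans ?_
      rw [← Category.assoc, freeUnit_snd, Category.id_comp]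
    apply Over.OverMorphism.ext
    rw [← key t, ← key t', h]
  obtain ⟨Y, ⟨θ⟩⟩ := Functor.EssSurj.mem_essImage (F := hf.toOver) Q
  obtain ⟨t, ht⟩ := hu θ.inv
  obtain ⟨s, hs⟩ := hf.toOver.map_surjective (θ.hom ≫ u)
  have h1 : s ≫ t = 𝟙 Y := hf.toOver.map_injective (by
    rw [Functor.map_comp, hs, Category.assoc, ← ht, Iso.hom_inv_id, CategoryTheory.Functor.map_id])
  have h2 : t ≫ s = 𝟙 F := hu' _ _ (by
    rw [Functor.map_comp, hs, ← Category.assoc, ← ht, Iso.inv_hom_id_assoc, CategoryTheory.Functor.map_id,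
      Category.comp_id])
  have : IsIso t := ⟨s, h2, h1⟩
  have hui : IsIso u := by
    have : u = θ.inv ≫ inv (hf.toOver.map t) := by rw [ht]; simp
    rw [this]; infer_instance
  have hui' : IsIso u.left.hom :=
    inferInstanceAs (IsIso ((Over.forget P ⋙ forget G).map u))
  let e : P.free.A ≅ (hf.pullbackObj F).A := @asIso _ _ _ _ u.left.hom hui'
  have sq : IsPullback P.freeSnd P.freeAct.hom f f :=
    (hf.isPullback F).of_iso e.symm (Iso.refl _) (Iso.refl _) (Iso.refl _)
      ((Category.comp_id _).trans ((Iso.eq_inv_comp e).2 (hf.pullbackLift_fst F _ P.isInvariant_freeSnd P.freeAct hw)))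
      ((Category.comp_id _).trans ((Iso.eq_inv_comp e).2
        (congrArg GObj.Hom.hom (hf.pullbackLift_snd F P.freeSnd P.isInvariant_freeSnd _ hw))))
      ((Category.comp_id _).trans (Category.id_comp _).symm)
      ((Category.comp_id _).trans (Category.id_comp _).symm)
  have := sq.flip
  rwa [freeAct_hom] at this

end GObj

end Torsor

section DescentData

attribute [local simp] pullback.lift_fst pullback.lift_snd pullback.lift_fst_assoc
  pullback.lift_snd_assoc prod.lift_fst prod.lift_snd prod.lift_fst_assoc prod.lift_snd_assoc

variable {C : Type u} [Category.{v} C] [HasPullbacks C] {Y X : C} (f : Y ⟶ X)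

/-- The monad on `C/Y` induced by pulling back along `f : Y ⟶ X`. -/
abbrev descentMonad : Monad (Over Y) := (Over.mapPullbackAdj f).toMonad

namespace descentMonad

/-- The first projection of the pullback underlying the descent monad. -/
def fst (B : Over Y) : ((descentMonad f).obj B).left ⟶ B.left := pullback.fst (B.hom ≫ f) f

/-- The second projection of the pullback underlying the descent monad. -/
def snd (B : Over Y) : ((descentMonad f).obj B).left ⟶ Y := pullback.snd (B.hom ≫ f) f

lemma isPullback (B : Over Y) : IsPullback (fst f B) (snd f B) (B.hom ≫ f) f :=
  IsPullback.of_hasPullback _ _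

lemma obj_hom (B : Over Y) : ((descentMonad f).obj B).hom = snd f B := rfl

lemma η_fst (B : Over Y) : ((descentMonad f).η.app B).left ≫ fst f B = 𝟙 B.left := by
  refine (congrArg (fun u => u.left ≫ fst f B) (Over.mapPullbackAdj_unit_app f B)).trans ?_
  exact pullback.lift_fst _ _ _

lemma η_snd (B : Over Y) : ((descentMonad f).η.app B).left ≫ snd f B = B.hom :=
  Over.w ((descentMonad f).η.app B)

lemma μ_fst (B : Over Y) : ((descentMonad f).μ.app B).left ≫ fst f B =
    fst f ((descentMonad f).obj B) ≫ fst f B := by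
  refine (pullback.lift_fst _ _ _).trans ?_
  refine congrArg (fst f ((descentMonad f).obj B) ≫ ·) ?_
  exact congrArg (fun u => u.left) (Over.mapPullbackAdj_counit_app f ((Over.map f).obj B))

lemma μ_snd (B : Over Y) : ((descentMonad f).μ.app B).left ≫ snd f B =
    snd f ((descentMonad f).obj B) :=
  Over.w ((descentMonad f).μ.app B)

lemma map_fst {B B' : Over Y} (u : B ⟶ B') :
    ((descentMonad f).map u).left ≫ fst f B' = fst f B ≫ u.left :=
  pullback.lift_fst _ _ _

lemma map_snd {B B' : Over Y} (u : B ⟶ B') :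
    ((descentMonad f).map u).left ≫ snd f B' = snd f B :=
  Over.w ((descentMonad f).map u)

end descentMonad

variable {f}

section

variable (B : (descentMonad f).Algebra) {S T : C}

/-- The structure morphism of an algebra of the descent monad, on generalized elements `b` of the
algebra and `y` of `Y`. -/
def algebraAp (b : T ⟶ B.A.left) (y : T ⟶ Y)
    (w : b ≫ B.A.hom ≫ f = y ≫ f) : T ⟶ B.A.left :=
  (descentMonad.isPullback f B.A).lift b y w ≫ B.a.left

lemma algebra_a_left_eq :
    B.a.left = algebraAp B (descentMonad.fst f B.A) (descentMonad.snd f B.A)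
      (descentMonad.isPullback f B.A).w := by
  refine (Category.id_comp _).symm.trans (congrArg (· ≫ B.a.left) ?_)
  apply (descentMonad.isPullback f B.A).hom_ext <;> simp

variable {B} in
lemma algebraAp_congr {b b' : T ⟶ B.A.left} {y y' : T ⟶ Y} (hb : b = b') (hy : y = y')
    (w : b ≫ B.A.hom ≫ f = y ≫ f) :
    algebraAp B b y w = algebraAp B b' y' (hb ▸ hy ▸ w) := by
  subst hb hy; rfl

variable (b : T ⟶ B.A.left) (y y' : T ⟶ Y)

lemma comp_algebraAp (t : S ⟶ T) (w : b ≫ B.A.hom ≫ f = y ≫ f) :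
    t ≫ algebraAp B b y w =
      algebraAp B (t ≫ b) (t ≫ y) (by rw [Category.assoc, w, Category.assoc]) := by
  refine (Category.assoc _ _ _).symm.trans (congrArg (· ≫ B.a.left) ?_)
  apply (descentMonad.isPullback f B.A).hom_ext <;> simp

lemma comp_algebra_a (t : T ⟶ ((descentMonad f).obj B.A).left) :
    t ≫ B.a.left = algebraAp B (t ≫ descentMonad.fst f B.A) (t ≫ descentMonad.snd f B.A)
      (by rw [Category.assoc, (descentMonad.isPullback f B.A).w, Category.assoc]) := by
  rw [algebra_a_left_eq, comp_algebraAp]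

lemma algebraAp_hom (w : b ≫ B.A.hom ≫ f = y ≫ f) : algebraAp B b y w ≫ B.A.hom = y := by
  rw [algebraAp, Category.assoc, Over.w B.a, descentMonad.obj_hom, IsPullback.lift_snd]

lemma algebraAp_unit (w : b ≫ B.A.hom ≫ f = y ≫ f) (hy : b ≫ B.A.hom = y) :
    algebraAp B b y w = b := by
  have h := congrArg (fun u => b ≫ u.left) B.unit
  refine Eq.trans ?_ (h.trans (Category.comp_id b))
  refine Eq.trans ?_ (congrArg (b ≫ ·) (Over.comp_left _ _ _ _ _)).symm
  rw [comp_algebra_a, comp_algebraAp]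
  refine algebraAp_congr ?_ ?_ _
  · rw [descentMonad.η_fst, Category.comp_id]
  · rw [descentMonad.η_snd, hy]

lemma algebraAp_assoc (w : b ≫ B.A.hom ≫ f = y ≫ f) (w' : y ≫ f = y' ≫ f) :
    algebraAp B (algebraAp B b y w) y' (by rw [← Category.assoc, algebraAp_hom, w']) =
      algebraAp B b y' (w.trans w') := by
  let q := (descentMonad.isPullback f ((descentMonad f).obj B.A)).lift
    ((descentMonad.isPullback f B.A).lift b y w) y' (by
      rw [descentMonad.obj_hom, IsPullback.lift_snd_assoc, w'])
  have h : q ≫ (((descentMonad f).μ.app B.A).left ≫ B.a.left) =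
      q ≫ (((descentMonad f).map B.a).left ≫ B.a.left) :=
    congrArg (fun u => q ≫ u.left) B.assoc
  rw [← Category.assoc, ← Category.assoc, comp_algebra_a, comp_algebra_a] at h
  refine Eq.trans ?_ (h.symm.trans ?_)
  · refine algebraAp_congr ?_ ?_ _
    · rw [Category.assoc, descentMonad.map_fst, IsPullback.lift_fst_assoc, algebraAp]
    · rw [Category.assoc, descentMonad.map_snd, IsPullback.lift_snd]
  · refine algebraAp_congr ?_ ?_ _
    · rw [Category.assoc, descentMonad.μ_fst, IsPullback.lift_fst_assoc, IsPullback.lift_fst]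
    · rw [Category.assoc, descentMonad.μ_snd, IsPullback.lift_snd]

variable {B} in
lemma algebraAp_homomorphism {B' : (descentMonad f).Algebra} (u : B ⟶ B')
    (w : b ≫ B.A.hom ≫ f = y ≫ f) :
    algebraAp B b y w ≫ u.f.left =
      algebraAp B' (b ≫ u.f.left) y (by rw [Category.assoc, Over.w_assoc, w]) := by
  have h : (descentMonad.isPullback f B.A).lift b y w ≫
      (((descentMonad f).map u.f).left ≫ B'.a.left) =
      (descentMonad.isPullback f B.A).lift b y w ≫ (B.a.left ≫ u.f.left) :=
    congrArg (fun t => (descentMonad.isPullback f B.A).lift b y w ≫ t.left) u.h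
  rw [← Category.assoc, comp_algebra_a] at h
  refine ((Category.assoc _ _ _).trans h.symm).trans (algebraAp_congr ?_ ?_ _)
  · rw [Category.assoc, descentMonad.map_fst, IsPullback.lift_fst_assoc]
  · rw [Category.assoc, descentMonad.map_snd, IsPullback.lift_snd]

end

/-- A morphism of algebras of the descent monad, from a condition on generalized elements. -/
def descentAlgebraHomMk {B B' : (descentMonad f).Algebra} (u : B.A ⟶ B'.A)
    (h : ∀ {T : C} (b : T ⟶ B.A.left) (y : T ⟶ Y) (w : b ≫ B.A.hom ≫ f = y ≫ f),
      algebraAp B b y w ≫ u.left =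
        algebraAp B' (b ≫ u.left) y (by rw [Category.assoc, Over.w_assoc, w])) : B ⟶ B' where
  f := u
  h := by
    apply Over.OverMorphism.ext
    rw [Over.comp_left, Over.comp_left, comp_algebra_a, algebra_a_left_eq B, h]
    exact algebraAp_congr (descentMonad.map_fst f u) (descentMonad.map_snd f u) _

section

variable (B : Over Y)
  (ap : ∀ {T : C} (b : T ⟶ B.left) (y : T ⟶ Y), b ≫ B.hom ≫ f = y ≫ f → (T ⟶ B.left))
  (comp_ap : ∀ {S T : C} (t : S ⟶ T) (b : T ⟶ B.left) (y : T ⟶ Y)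
    (w : b ≫ B.hom ≫ f = y ≫ f) (w' : (t ≫ b) ≫ B.hom ≫ f = (t ≫ y) ≫ f),
    t ≫ ap b y w = ap (t ≫ b) (t ≫ y) w')
  (ap_hom : ∀ {T : C} (b : T ⟶ B.left) (y : T ⟶ Y) (w : b ≫ B.hom ≫ f = y ≫ f),
    ap b y w ≫ B.hom = y)
  (ap_unit : ∀ {T : C} (b : T ⟶ B.left) (w : b ≫ B.hom ≫ f = (b ≫ B.hom) ≫ f),
    ap b (b ≫ B.hom) w = b)
  (ap_assoc : ∀ {T : C} (b : T ⟶ B.left) (y y' : T ⟶ Y) (w : b ≫ B.hom ≫ f = y ≫ f)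
    (w' : ap b y w ≫ B.hom ≫ f = y' ≫ f) (w'' : b ≫ B.hom ≫ f = y' ≫ f),
    ap (ap b y w) y' w' = ap b y' w'')

/-- An algebra of the descent monad from an operation on generalized elements. -/
def descentAlgebraMk : (descentMonad f).Algebra :=
  have congr : ∀ {T : C} {b b' : T ⟶ B.left} {y y' : T ⟶ Y} (_ : b = b') (_ : y = y')
      (w : b ≫ B.hom ≫ f = y ≫ f) (w' : b' ≫ B.hom ≫ f = y' ≫ f), ap b y w = ap b' y' w' := by
    intro T b b' y y' hb hy w w'
    subst hb hy; rfl
  let a : ((descentMonad f).obj B).left ⟶ B.left :=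
    ap (descentMonad.fst f B) (descentMonad.snd f B) (descentMonad.isPullback f B).w
  have comp_a : ∀ {T : C} (t : T ⟶ ((descentMonad f).obj B).left)
      (w : (t ≫ descentMonad.fst f B) ≫ B.hom ≫ f = (t ≫ descentMonad.snd f B) ≫ f),
      t ≫ a = ap (t ≫ descentMonad.fst f B) (t ≫ descentMonad.snd f B) w :=
    fun t w => comp_ap t _ _ _ w
  have w : ∀ {T : C} (t : T ⟶ ((descentMonad f).obj B).left),
      (t ≫ descentMonad.fst f B) ≫ B.hom ≫ f = (t ≫ descentMonad.snd f B) ≫ f := fun t => by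
    rw [Category.assoc, (descentMonad.isPullback f B).w, Category.assoc]
  let α : (descentMonad f).obj B ⟶ B := Over.homMk a (ap_hom _ _ _)
  { A := B
    a := α
    unit := by
      apply Over.OverMorphism.ext
      change ((descentMonad f).η.app B).left ≫ a = 𝟙 B.left
      rw [comp_a _ (w _)]
      exact (congr (descentMonad.η_fst f B) ((descentMonad.η_snd f B).trans
        (Category.id_comp B.hom).symm) _ (by simp)).trans (ap_unit _ _)
    assoc := by
      apply Over.OverMorphism.ext
      change ((descentMonad f).μ.app B).left ≫ a = ((descentMonad f).map α).left ≫ a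
      rw [comp_a _ (w _), comp_a _ (w _)]
      have h₁ : ((descentMonad f).map α).left ≫ descentMonad.fst f B =
          ap (descentMonad.fst f ((descentMonad f).obj B) ≫ descentMonad.fst f B)
            (descentMonad.fst f ((descentMonad f).obj B) ≫ descentMonad.snd f B) (w _) := by
        rw [descentMonad.map_fst]
        exact comp_a _ (w _)
      have h₂ := descentMonad.map_snd f α
      have h₃ := w ((descentMonad f).map α).left
      have h₄ := w ((descentMonad f).μ.app B).left
      rw [h₁, h₂] at h₃
      rw [descentMonad.μ_fst, descentMonad.μ_snd] at h₄
      exact (congr (descentMonad.μ_fst f B) (descentMonad.μ_snd f B) _ h₄).trans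
        ((ap_assoc _ _ _ (w _) h₃ h₄).symm.trans (congr h₁ h₂ _ _).symm) }

lemma algebraAp_descentAlgebraMk {T : C} (b : T ⟶ B.left) (y : T ⟶ Y)
    (w : b ≫ B.hom ≫ f = y ≫ f) :
    algebraAp (descentAlgebraMk B ap comp_ap ap_hom ap_unit ap_assoc) b y w = ap b y w := by
  refine (comp_ap _ _ _ _ ?_).trans ?_
  · exact (congrArg (· ≫ B.hom ≫ f) (IsPullback.lift_fst _ _ _ _)).trans
      (w.trans (congrArg (· ≫ f) (IsPullback.lift_snd _ _ _ _)).symm)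
  · congr 1
    · exact IsPullback.lift_fst _ _ _ _
    · exact IsPullback.lift_snd _ _ _ _

end

end DescentData

section Descent

attribute [local simp] pullback.lift_fst pullback.lift_snd pullback.lift_fst_assoc
  pullback.lift_snd_assoc prod.lift_fst prod.lift_snd prod.lift_fst_assoc prod.lift_snd_assoc

variable {C : Type u} [Category.{v} C] [HasPullbacks C] {G : InternalGroupoid C}

namespace GObj

variable {P : GObj G} {X : C} {f : P.A ⟶ X}

/-- The element `k` of `G₁` with `k * p' = p`, for elements `p` and `p'` of a torsor in the same
fibre. -/
def div (hP : IsPullback P.act (pullback.snd G.d₀ P.g) f f) {T : C} (p p' : T ⟶ P.A)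
    (w : p ≫ f = p' ≫ f) : T ⟶ G.G₁ :=
  hP.lift p p' w ≫ pullback.fst G.d₀ P.g

variable (hP : IsPullback P.act (pullback.snd G.d₀ P.g) f f) {S T : C} (p p' p'' : T ⟶ P.A)

lemma div_d₀ (w : p ≫ f = p' ≫ f) : div hP p p' w ≫ G.d₀ = p' ≫ P.g := by
  rw [div, Category.assoc, pullback.condition, IsPullback.lift_snd_assoc]

lemma ap_div (w : p ≫ f = p' ≫ f) : P.ap (div hP p p' w) p' (div_d₀ hP p p' w) = p := by
  have e : pullback.lift (div hP p p' w) p' (div_d₀ hP p p' w) = hP.lift p p' w := by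
    apply pullback.hom_ext
    · rw [pullback.lift_fst, div]
    · rw [pullback.lift_snd, IsPullback.lift_snd]
  rw [ap, e, IsPullback.lift_fst]

lemma div_d₁ (w : p ≫ f = p' ≫ f) : div hP p p' w ≫ G.d₁ = p ≫ P.g := by
  rw [← P.ap_g _ _ (div_d₀ hP p p' w), ap_div]

variable {p p'} in
lemma eq_div (k : T ⟶ G.G₁) (hk : k ≫ G.d₀ = p' ≫ P.g) (h : P.ap k p' hk = p)
    (w : p ≫ f = p' ≫ f) : k = div hP p p' w := by
  have e : hP.lift p p' w = pullback.lift k p' hk := by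
    apply hP.hom_ext
    · rw [IsPullback.lift_fst]; exact h.symm
    · rw [IsPullback.lift_snd, pullback.lift_snd]
  rw [div, e, pullback.lift_fst]

lemma comp_div (t : S ⟶ T) (w : p ≫ f = p' ≫ f) :
    t ≫ div hP p p' w = div hP (t ≫ p) (t ≫ p') (by rw [Category.assoc, w, Category.assoc]) := by
  apply eq_div
  rw [← comp_ap _ _ _ (div_d₀ hP p p' w), ap_div]

variable {p p'} in
lemma div_congr {q q' : T ⟶ P.A} (h : p = q) (h' : p' = q') (w : p ≫ f = p' ≫ f) :
    div hP p p' w = div hP q q' (h ▸ h' ▸ w) := by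
  subst h h'; rfl

lemma mul_div (w : p ≫ f = p' ≫ f) (w' : p' ≫ f = p'' ≫ f) :
    G.mul (div hP p p' w) (div hP p' p'' w') (by rw [div_d₀, div_d₁]) =
      div hP p p'' (w.trans w') := by
  apply eq_div
  rw [ap_mul _ _ _ _ (div_d₀ hP p' p'' w')]
  exact (ap_congr rfl (ap_div hP p' p'' w') _).trans (ap_div hP p p' w)

lemma div_self (w : p ≫ f = p ≫ f) : div hP p p w = (p ≫ P.g) ≫ G.e := by
  symm
  apply eq_div
  · exact ap_one _ _ (by rw [Category.assoc, G.e_d₀, Category.comp_id]) rfl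

section

variable (Q : Over P)

/-- The translate of an element `q` of a `G`-object over a torsor to the element of the fibre over
`p`. -/
def transport (q : T ⟶ Q.left.A) (p : T ⟶ P.A) (w : q ≫ Q.hom.hom ≫ f = p ≫ f) :
    T ⟶ Q.left.A :=
  Q.left.ap (div hP p (q ≫ Q.hom.hom) (w.symm.trans (Category.assoc _ _ _).symm)) q
    (by rw [div_d₀, Category.assoc, Q.hom.hom_g])

variable (q : T ⟶ Q.left.A)

lemma comp_transport (t : S ⟶ T) (w : q ≫ Q.hom.hom ≫ f = p ≫ f)
    (w' : (t ≫ q) ≫ Q.hom.hom ≫ f = (t ≫ p) ≫ f) :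
    t ≫ transport hP Q q p w = transport hP Q (t ≫ q) (t ≫ p) w' :=
  (comp_ap _ _ _ _).trans (ap_congr ((comp_div hP _ _ _ _).trans
    (div_congr hP rfl (Category.assoc _ _ _).symm _)) rfl _)

lemma transport_hom (w : q ≫ Q.hom.hom ≫ f = p ≫ f) :
    transport hP Q q p w ≫ Q.hom.hom = p :=
  (ap_hom _ _ _ _).trans (ap_div hP _ _ _)

lemma transport_self (w : q ≫ Q.hom.hom ≫ f = (q ≫ Q.hom.hom) ≫ f) :
    transport hP Q q (q ≫ Q.hom.hom) w = q := by
  refine ap_one _ _ _ ((div_self hP _ _).trans ?_)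
  exact congrArg (· ≫ G.e) ((Category.assoc _ _ _).trans (congrArg (q ≫ ·) Q.hom.hom_g))

lemma transport_transport (w : q ≫ Q.hom.hom ≫ f = p ≫ f)
    (w' : transport hP Q q p w ≫ Q.hom.hom ≫ f = p' ≫ f) (w'' : q ≫ Q.hom.hom ≫ f = p' ≫ f) :
    transport hP Q (transport hP Q q p w) p' w' = transport hP Q q p' w'' := by
  have h : p' ≫ f = p ≫ f := w''.symm.trans w
  have hd : q ≫ Q.hom.hom ≫ f = (q ≫ Q.hom.hom) ≫ f := (Category.assoc _ _ _).symm
  have e : div hP p' (transport hP Q q p w ≫ Q.hom.hom)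
      (w'.symm.trans (Category.assoc _ _ _).symm) = div hP p' p h :=
    div_congr hP rfl (transport_hom hP p Q q w) _
  refine (ap_congr e rfl _).trans ?_
  refine (ap_mul _ _ _ (by rw [div_d₀, div_d₁]) _).symm.trans ?_
  exact ap_congr (mul_div hP _ _ _ h (w.symm.trans hd)) rfl _

end

/-- The algebra of the descent monad given by a `G`-object over a torsor. -/
def toDescentAlgebra (Q : Over P) : (descentMonad f).Algebra :=
  descentAlgebraMk (Over.mk Q.hom.hom) (fun q p w => transport hP Q q p w)
    (fun t q p w w' => comp_transport hP p Q q t w w') (fun q p w => transport_hom hP p Q q w)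
    (fun q w => transport_self hP Q q w)
    (fun q p p' w w' w'' => transport_transport hP p p' Q q w w' w'')

lemma algebraAp_toDescentAlgebra (Q : Over P) (q : T ⟶ Q.left.A)
    (w : q ≫ Q.hom.hom ≫ f = p ≫ f) :
    algebraAp (toDescentAlgebra hP Q) q p w = transport hP Q q p w :=
  algebraAp_descentAlgebraMk _ _ _ _ _ _ _ _ _

lemma transport_homomorphism {Q Q' : Over P} (u : Q ⟶ Q') (q : T ⟶ Q.left.A)
    (w : q ≫ Q.hom.hom ≫ f = p ≫ f) (w' : (q ≫ u.left.hom) ≫ Q'.hom.hom ≫ f = p ≫ f) :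
    transport hP Q q p w ≫ u.left.hom = transport hP Q' (q ≫ u.left.hom) p w' := by
  have hu : u.left.hom ≫ Q'.hom.hom = Q.hom.hom := congrArg GObj.Hom.hom (Over.w u)
  refine (ap_hom _ _ _ _).trans (ap_congr (div_congr hP rfl ?_ _) rfl _)
  rw [Category.assoc, hu]

/-- The functor from `G`-objects over a torsor to algebras of the descent monad. -/
def descentFunctor : Over P ⥤ (descentMonad f).Algebra where
  obj Q := toDescentAlgebra hP Q
  map {Q Q'} u := descentAlgebraHomMk (B := toDescentAlgebra hP Q) (B' := toDescentAlgebra hP Q')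
    (Over.homMk (U := Over.mk Q.hom.hom) (V := Over.mk Q'.hom.hom) u.left.hom
      (congrArg GObj.Hom.hom (Over.w u)))
    fun b y w => (congrArg (· ≫ u.left.hom) (algebraAp_toDescentAlgebra hP y Q b w)).trans
      ((transport_homomorphism hP y u b w _).trans
        (algebraAp_toDescentAlgebra hP y Q' (b ≫ u.left.hom) _).symm)
  map_id _ := rfl
  map_comp _ _ := rfl

instance : (descentFunctor hP).Faithful where
  map_injective {_ _} _ _ h := Over.OverMorphism.ext (GObj.hom_ext
    (congrArg (fun t : (_ : (descentMonad f).Algebra) ⟶ _ => t.f.left) h))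

instance : (descentFunctor hP).Full where
  map_surjective {Q Q'} v := by
    let u : Q.left.A ⟶ Q'.left.A := v.f.left
    have hu : u ≫ Q'.hom.hom = Q.hom.hom := Over.w v.f
    have hv : ∀ {T : C} (q : T ⟶ Q.left.A) (p : T ⟶ P.A) (w : q ≫ Q.hom.hom ≫ f = p ≫ f)
        (w' : (q ≫ u) ≫ Q'.hom.hom ≫ f = p ≫ f),
        transport hP Q q p w ≫ u = transport hP Q' (q ≫ u) p w' := by
      intro T q p w w'
      rw [← algebraAp_toDescentAlgebra, ← algebraAp_toDescentAlgebra]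
      exact algebraAp_homomorphism q p v w
    refine ⟨Over.homMk (homMk u ?_ ?_) (GObj.hom_ext hu), rfl⟩
    · rw [← Q'.hom.hom_g, ← Category.assoc, hu, Q.hom.hom_g]
    · intro T k q w
      have hq : k ≫ G.d₀ = (q ≫ Q.hom.hom) ≫ P.g := by rw [w, Category.assoc, Q.hom.hom_g]
      have h₁ : q ≫ Q.hom.hom ≫ f = P.ap k (q ≫ Q.hom.hom) hq ≫ f := by
        rw [IsInvariant.ap hP.w, Category.assoc]
      have h₂ : (q ≫ u) ≫ Q'.hom.hom = q ≫ Q.hom.hom := by rw [Category.assoc, hu]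
      have h₃ : (q ≫ u) ≫ Q'.hom.hom ≫ f = P.ap k (q ≫ Q.hom.hom) hq ≫ f := by
        rw [← Category.assoc, h₂, Category.assoc, h₁]
      refine Eq.trans ?_ ((hv q (P.ap k (q ≫ Q.hom.hom) hq) h₁ h₃).trans ?_)
      · exact congrArg (· ≫ u) (ap_congr (eq_div hP k hq rfl _) rfl _)
      · exact ap_congr ((div_congr hP rfl h₂ _).trans (eq_div hP k hq rfl _).symm) rfl _

include hP in
lemma algebra_hom_comp (B : (descentMonad f).Algebra) (k : T ⟶ G.G₁) (b : T ⟶ B.A.left)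
    (w : k ≫ G.d₀ = (b ≫ B.A.hom) ≫ P.g) :
    b ≫ B.A.hom ≫ f = P.ap k (b ≫ B.A.hom) w ≫ f := by
  rw [IsInvariant.ap hP.w, Category.assoc]

/-- The `G`-object over a torsor given by an algebra of the descent monad. -/
def ofDescentAlgebra (B : (descentMonad f).Algebra) : GObj G :=
  ofAp B.A.left (B.A.hom ≫ P.g)
    (fun k b w => algebraAp B b (P.ap k (b ≫ B.A.hom) (w.trans (Category.assoc _ _ _).symm))
      (algebra_hom_comp hP B k b _))
    (fun t k b w w' => (comp_algebraAp B _ _ _ _).trans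
      (algebraAp_congr rfl ((comp_ap _ _ _ _).trans
        (ap_congr rfl (Category.assoc _ _ _).symm _)) _))
    (fun k b w => by rw [← Category.assoc, algebraAp_hom, ap_g])
    (fun b w => algebraAp_unit _ _ _ _
      (ap_one _ _ _ (congrArg (· ≫ G.e) (Category.assoc _ _ _).symm)).symm)
    (fun k h b hkh hhb w w' => by
      have hh : h ≫ G.d₀ = (b ≫ B.A.hom) ≫ P.g := hhb.trans (Category.assoc _ _ _).symm
      have h₁ := algebra_hom_comp hP B h b hh
      have h₂ : P.ap h (b ≫ B.A.hom) hh ≫ f = P.ap k (P.ap h (b ≫ B.A.hom) hh)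
          (by rw [ap_g]; exact hkh) ≫ f := by
        exact (IsInvariant.ap hP.w k _ _).symm
      refine (algebraAp_congr rfl (ap_mul _ _ _ hkh hh) _).trans ?_
      refine (algebraAp_assoc B _ _ _ h₁ h₂).symm.trans (algebraAp_congr rfl ?_ _)
      exact ap_congr rfl (algebraAp_hom _ _ _ _).symm _)

lemma ap_ofDescentAlgebra (B : (descentMonad f).Algebra) (k : T ⟶ G.G₁) (b : T ⟶ B.A.left)
    (w : k ≫ G.d₀ = b ≫ B.A.hom ≫ P.g) :
    (ofDescentAlgebra hP B).ap k b w =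
      algebraAp B b (P.ap k (b ≫ B.A.hom) (w.trans (Category.assoc _ _ _).symm))
        (algebra_hom_comp hP B k b _) :=
  (comp_algebraAp B _ _ _ _).trans (algebraAp_congr (pullback.lift_snd _ _ _)
    ((comp_ap _ _ _ _).trans (ap_congr (pullback.lift_fst _ _ _)
      (pullback.lift_snd_assoc _ _ _ _) _)) _)

instance : (descentFunctor hP).EssSurj where
  mem_essImage B := by
    let q : ofDescentAlgebra hP B ⟶ P := homMk B.A.hom rfl fun k b w =>
      (congrArg (· ≫ B.A.hom) (ap_ofDescentAlgebra hP B k b w)).trans (algebraAp_hom _ _ _ _)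
    let Q : Over P := Over.mk q
    have e : ∀ {T : C} (b : T ⟶ B.A.left) (p : T ⟶ P.A) (w : b ≫ B.A.hom ≫ f = p ≫ f),
        transport hP Q b p w = algebraAp B b p w := fun b p w =>
      (ap_ofDescentAlgebra hP B _ _ _).trans (algebraAp_congr rfl (ap_div hP _ _ _) _)
    let u : toDescentAlgebra hP Q ⟶ B := descentAlgebraHomMk (B := toDescentAlgebra hP Q)
      (B' := B) (Over.homMk (𝟙 B.A.left) (Category.id_comp B.A.hom)) fun b p w =>
        (Category.comp_id _).trans ((algebraAp_toDescentAlgebra hP p Q b w).trans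
          ((e b p w).trans (algebraAp_congr (B := B) (Category.comp_id b).symm rfl _)))
    have : IsIso ((descentMonad f).forget.map u) := by
      have : IsIso ((Over.forget P.A).map ((descentMonad f).forget.map u)) :=
        inferInstanceAs (IsIso (𝟙 B.A.left))
      exact isIso_of_reflects_iso _ (Over.forget P.A)
    have : IsIso u := isIso_of_reflects_iso u (descentMonad f).forget
    exact ⟨Q, ⟨@asIso _ _ _ _ u this⟩⟩

instance : (descentFunctor hP).IsEquivalence where

lemma algebraAp_comparison (W : Over X) {T : C}
    (b : T ⟶ ((Monad.comparison (Over.mapPullbackAdj f)).obj W).A.left) (p : T ⟶ P.A)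
    (w : b ≫ ((Monad.comparison (Over.mapPullbackAdj f)).obj W).A.hom ≫ f = p ≫ f) :
    algebraAp ((Monad.comparison (Over.mapPullbackAdj f)).obj W) b p w ≫ pullback.fst W.hom f =
      b ≫ pullback.fst W.hom f := by
  let B := (Monad.comparison (Over.mapPullbackAdj f)).obj W
  have h : B.a.left ≫ pullback.fst W.hom f =
      descentMonad.fst f B.A ≫ pullback.fst W.hom f := by
    refine (pullback.lift_fst _ _ _).trans (congrArg (descentMonad.fst f B.A ≫ ·) ?_)
    exact congrArg (fun u => u.left) (Over.mapPullbackAdj_counit_app f W)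
  refine (Category.assoc _ _ _).trans ((congrArg (_ ≫ ·) h).trans ?_)
  exact IsPullback.lift_fst_assoc _ _ _ _ _

/-- Under the correspondence of `G`-objects over a torsor with algebras of the descent monad, the
functor `W ↦ W ×_X P` becomes the comparison functor. -/
def toOverCompDescentFunctor :
    IsInvariant.toOver hP.w ⋙ descentFunctor hP ≅ Monad.comparison (Over.mapPullbackAdj f) :=
  have hf : P.IsInvariant f := hP.w
  have e : ∀ (W : Over X) {T : C} (b : T ⟶ (hf.pullbackObj W).A) (p : T ⟶ P.A)
      (w : b ≫ (hf.pullbackSnd W).hom ≫ f = p ≫ f),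
      transport hP (hf.toOver.obj W) b p w =
        algebraAp ((Monad.comparison (Over.mapPullbackAdj f)).obj W) b p w := by
    intro W T b p w
    apply (hf.isPullback W).hom_ext
    · exact (hf.ap_pullbackFst W _ _ _).trans (algebraAp_comparison W b p w).symm
    · exact (transport_hom hP p (hf.toOver.obj W) b w).trans (algebraAp_hom _ _ _ _).symm
  NatIso.ofComponents (fun W => Monad.Algebra.isoMk (Iso.refl _) (by
    let B := (toDescentAlgebra hP (hf.toOver.obj W))
    let B' := ((Monad.comparison (Over.mapPullbackAdj f)).obj W)
    let u : B ⟶ B' := descentAlgebraHomMk (B := B) (B' := B')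
      (Over.homMk (U := B.A) (V := B'.A) (𝟙 B.A.left) (Category.id_comp B.A.hom))
      fun b p w => (Category.comp_id _).trans ((algebraAp_toDescentAlgebra hP p _ b w).trans
          ((e W b p w).trans (algebraAp_congr (B := B') (Category.comp_id b).symm rfl _)))
    exact u.h))
    (fun {W W'} s => Monad.Algebra.Hom.ext (Over.OverMorphism.ext (by
      refine Eq.trans (Category.comp_id (hf.pullbackMap s).hom) (Eq.trans ?_
        (Category.id_comp ((Over.pullback f).map s).left).symm)
      apply (hf.isPullback W').hom_ext
      · exact (hf.pullbackMap_fst s).trans (pullback.lift_fst _ _ _).symm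
      · exact (congrArg GObj.Hom.hom (hf.pullbackMap_snd s)).trans (pullback.lift_snd _ _ _).symm)))

lemma isEquivalence_toOver_iff :
    (IsInvariant.toOver hP.w).IsEquivalence ↔ IsEffectiveDescent f := by
  constructor
  · intro h
    exact ⟨{ L := Over.map f, adj := Over.mapPullbackAdj f
             eqv := Functor.isEquivalence_of_iso (toOverCompDescentFunctor hP) }⟩
  · rintro ⟨h⟩
    have : (Monad.comparison (Over.mapPullbackAdj f)).IsEquivalence :=
      comparison_isEquivalence_of_leftAdjoints h.adj _
    have : (IsInvariant.toOver hP.w ⋙ descentFunctor hP).IsEquivalence :=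
      Functor.isEquivalence_of_iso (toOverCompDescentFunctor hP).symm
    exact Functor.isEquivalence_of_comp_right _ (descentFunctor hP)

end GObj

end Descent

section Invariants

variable {C : Type u} [Category.{v} C] [HasFiniteLimits C] {G : InternalGroupoid C}

namespace GObj

variable (G) in
/-- The invariant projection `G^* Y ⟶ Y`. -/
def gstarSnd (Y : C) : ((GStar G).obj Y).A ⟶ Y := (prod.snd : G.G₀ ⨯ Y ⟶ Y)

lemma isInvariant_gstarSnd (Y : C) : ((GStar G).obj Y).IsInvariant (gstarSnd G Y) :=
  prod.lift_snd _ _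

lemma gstar_map_snd {Y Y' : C} (y : Y ⟶ Y') :
    ((GStar G).map y).hom ≫ gstarSnd G Y' = gstarSnd G Y ≫ y :=
  prod.map_snd _ _

/-- The morphism into `G^* Y` given by an invariant morphism into `Y`. -/
def toGStar {A : GObj G} {Y : C} (c : A.A ⟶ Y) (hc : A.IsInvariant c) : A ⟶ (GStar G).obj Y :=
  homMk (B := (GStar G).obj Y) (prod.lift A.g c : A.A ⟶ G.G₀ ⨯ Y) (prod.lift_fst _ _)
    fun k a w => by
      apply Limits.prod.hom_ext
      · refine (Category.assoc _ _ _).trans ((congrArg (_ ≫ ·) (prod.lift_fst _ _)).trans ?_)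
        exact (A.ap_g k a w).trans (((GStar G).obj Y).ap_g k _ _).symm
      · refine (Category.assoc _ _ _).trans ((congrArg (_ ≫ ·) (prod.lift_snd _ _)).trans ?_)
        refine (hc.ap k a w).trans (Eq.trans ?_ ((isInvariant_gstarSnd Y).ap k _ _).symm)
        exact (congrArg (a ≫ ·) (prod.lift_snd _ _)).symm.trans (Category.assoc _ _ _).symm

@[simp]
lemma toGStar_snd {A : GObj G} {Y : C} (c : A.A ⟶ Y) (hc : A.IsInvariant c) :
    (toGStar c hc).hom ≫ gstarSnd G Y = c :=
  prod.lift_snd _ _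

@[simp]
lemma toGStar_snd_assoc {A : GObj G} {Y : C} (c : A.A ⟶ Y) (hc : A.IsInvariant c) {Z : C}
    (h : Y ⟶ Z) : (toGStar c hc).hom ≫ gstarSnd G Y ≫ h = c ≫ h := by
  rw [← Category.assoc, toGStar_snd]

lemma gstar_hom_ext {A : GObj G} {Y : C} {u u' : A ⟶ (GStar G).obj Y}
    (h : u.hom ≫ gstarSnd G Y = u'.hom ≫ gstarSnd G Y) : u = u' :=
  GObj.hom_ext (Limits.prod.hom_ext (u.hom_g.trans u'.hom_g.symm) h)

lemma isPullback_gstar {Y Y' : C} (y : Y ⟶ Y') :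
    IsPullback ((GStar G).map y).hom (gstarSnd G Y) (gstarSnd G Y') y := by
  refine ⟨⟨gstar_map_snd y⟩, ⟨PullbackCone.IsLimit.mk _
    (fun s => prod.lift (s.fst ≫ ((GStar G).obj Y').g) s.snd) (fun s => ?_)
    (fun s => prod.lift_snd _ _) (fun s m h₁ h₂ => ?_)⟩⟩
  · apply Limits.prod.hom_ext
    · refine (Category.assoc _ _ _).trans ((congrArg (_ ≫ ·)
        ((GStar G).map y).hom_g).trans (prod.lift_fst _ _))
    · refine (Category.assoc _ _ _).trans ((congrArg (_ ≫ ·) (gstar_map_snd y)).trans ?_)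
      exact (prod.lift_snd_assoc _ _ _).trans s.condition.symm
  · apply Limits.prod.hom_ext
    · refine Eq.trans ?_ (prod.lift_fst _ _).symm
      refine ((congrArg (m ≫ ·) ((GStar G).map y).hom_g).symm.trans (Category.assoc _ _ _).symm).trans
        (congrArg (· ≫ ((GStar G).obj Y').g) h₁)
    · exact h₂.trans (prod.lift_snd _ _).symm

instance : HasTerminal (GObj G) :=
  have : ∀ A : GObj G, Unique (A ⟶ (GStar G).obj (⊤_ C)) := fun A =>
    { default := toGStar (terminal.from A.A) (Subsingleton.elim _ _)
      uniq := fun _ => gstar_hom_ext (Subsingleton.elim _ _) }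
  hasTerminal_of_unique ((GStar G).obj (⊤_ C))

instance : HasBinaryProducts (GObj G) := hasBinaryProducts_of_hasTerminal_and_pullbacks _

variable {P : GObj G} {X : C} {f : P.A ⟶ X}

namespace IsInvariant

variable (hf : P.IsInvariant f)

lemma exists_pullbackFst_comp [hf.toOver.Full] {W : Over X} {Z : C}
    {c : (hf.pullbackObj W).A ⟶ Z} (hc : (hf.pullbackObj W).IsInvariant c) :
    ∃ h : W.left ⟶ Z, hf.pullbackFst W ≫ h = c := by
  let V : Over X := Over.mk (prod.fst : X ⨯ Z ⟶ X)
  have hl : (hf.pullbackObj W).IsInvariant (prod.lift (hf.pullbackFst W ≫ W.hom) c) :=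
    .of_ap fun k p w => by
      apply Limits.prod.hom_ext
      · rw [Category.assoc, Category.assoc, prod.lift_fst,
          ((hf.isInvariant_pullbackFst W).comp W.hom).ap]
      · rw [Category.assoc, Category.assoc, prod.lift_snd, hc.ap]
  let θ : hf.toOver.obj W ⟶ hf.toOver.obj V :=
    Over.homMk (hf.pullbackLift V _ hl (hf.pullbackSnd W)
      ((prod.lift_fst _ _).trans (hf.isPullback W).w)) (hf.pullbackLift_snd _ _ _ _ _)
  obtain ⟨s, hs⟩ := hf.toOver.map_surjective θ
  have hs' : hf.pullbackFst W ≫ s.left = prod.lift (hf.pullbackFst W ≫ W.hom) c :=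
    (hf.pullbackMap_fst s).symm.trans
      ((congrArg (fun t => t.left.hom ≫ hf.pullbackFst V) hs).trans (hf.pullbackLift_fst _ _ hl _ _))
  refine ⟨s.left ≫ (prod.snd : X ⨯ Z ⟶ Z), ?_⟩
  rw [← Category.assoc, hs']
  exact prod.lift_snd _ _

lemma pullbackFst_comp_injective [hf.toOver.Faithful] {W : Over X} {Z : C} {h h' : W.left ⟶ Z}
    (e : hf.pullbackFst W ≫ h = hf.pullbackFst W ≫ h') : h = h' := by
  let V : Over X := Over.mk (prod.fst : X ⨯ Z ⟶ X)
  let s : ∀ _ : W.left ⟶ Z, (W ⟶ V) := fun h =>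
    Over.homMk (prod.lift W.hom h) (prod.lift_fst _ _)
  have hs : s h = s h' := by
    apply hf.toOver.map_injective
    apply Over.OverMorphism.ext
    refine hf.pullbackObj_hom_ext (u := hf.pullbackMap (s h)) (u' := hf.pullbackMap (s h')) ?_ ?_
    · rw [pullbackMap_fst, pullbackMap_fst]
      apply Limits.prod.hom_ext
      · refine (Category.assoc _ _ _).trans (Eq.trans ?_ (Category.assoc _ _ _).symm)
        exact congrArg (_ ≫ ·) ((prod.lift_fst _ _).trans (prod.lift_fst _ _).symm)
      · refine (Category.assoc _ _ _).trans (Eq.trans ?_ (Category.assoc _ _ _).symm)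
        refine (congrArg (_ ≫ ·) (prod.lift_snd _ _)).trans (e.trans ?_)
        exact (congrArg (_ ≫ ·) (prod.lift_snd _ _)).symm
    · rw [pullbackMap_snd, pullbackMap_snd]
  exact (prod.lift_snd W.hom h).symm.trans
    ((congrArg (fun t => t.left ≫ (prod.snd : X ⨯ Z ⟶ Z)) hs).trans (prod.lift_snd W.hom h'))

end IsInvariant

end GObj

end Invariants

section BundleAdjunction

lemma isPullback_prod_snd {E : Type u₁} [Category.{v₁} E] [HasBinaryProducts E] (A : E) {V Z : E}
    (v : V ⟶ Z) : IsPullback (prod.snd : A ⨯ V ⟶ V) (prod.map (𝟙 A) v) v (prod.snd : A ⨯ Z ⟶ Z) :=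
  ⟨⟨(prod.map_snd _ _).symm⟩, ⟨PullbackCone.IsLimit.mk _
    (fun s => prod.lift (s.snd ≫ prod.fst) s.fst) (fun _ => prod.lift_snd _ _)
    (fun s => by
      apply Limits.prod.hom_ext
      · rw [Category.assoc, prod.map_fst, Category.comp_id, prod.lift_fst]
      · rw [Category.assoc, prod.map_snd, prod.lift_snd_assoc, s.condition])
    (fun s m h₁ h₂ => by
      apply Limits.prod.hom_ext
      · rw [prod.lift_fst, ← h₂, Category.assoc, prod.map_fst, Category.comp_id]
      · rw [prod.lift_snd, h₁])⟩⟩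

section

variable {D : Type u₁} [Category.{v₁} D] {E : Type u₂} [Category.{v₂} E]

/-- The adjunction between `L ⊣ R`, where `L` is an equivalence onto `E/P` followed by the
forgetful functor, is stably Frobenius. -/
lemma isStablyFrobenius_equivalence_comp_forget [HasPullbacks D] [HasPullbacks E]
    [HasBinaryProducts E] {P : E} (e : D ≌ Over P) :
    IsStablyFrobenius (e.toAdjunction.comp (Over.forgetAdjStar P)) := by
  have : PreservesLimitsOfShape WalkingCospan (e.functor ⋙ Over.forget P) := inferInstance
  refine isStablyFrobenius_of_counit_cartesian _ fun V Z v => ?_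
  have hc : ∀ Z : E, (e.toAdjunction.comp (Over.forgetAdjStar P)).counit.app Z =
      (e.toAdjunction.counit.app ((Over.star P).obj Z)).left ≫ (prod.snd : P ⨯ Z ⟶ Z) := by
    intro Z
    rw [Adjunction.comp_counit_app, Over.forgetAdjStar_counit_app]
    rfl
  rw [hc, hc]
  have h₁ : IsPullback (e.toAdjunction.counit.app ((Over.star P).obj V)).left
      ((e.functor ⋙ Over.forget P).map ((Over.star P ⋙ e.inverse).map v))
      ((Over.star P).map v).left (e.toAdjunction.counit.app ((Over.star P).obj Z)).left := by
    have i : ∀ Z : E, IsIso (e.toAdjunction.counit.app ((Over.star P).obj Z)).left := fun Z =>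
      inferInstanceAs (IsIso ((Over.forget P).map (e.toAdjunction.counit.app ((Over.star P).obj Z))))
    exact @IsPullback.of_horiz_isIso _ _ _ _ _ _ _ _ _ _ (i V) (i Z) ⟨congrArg (fun t => t.left)
      (e.toAdjunction.counit.naturality ((Over.star P).map v)).symm⟩
  refine h₁.paste_horiz ?_
  have hv : ((Over.star P).map v).left = prod.map (𝟙 P) v := Over.star_map_left _ _
  have h₂ := isPullback_prod_snd P v
  rwa [← hv] at h₂

end

variable {C : Type u} [Category.{v} C] [HasFiniteLimits C] {G : InternalGroupoid C}
  {SigmaG : GObj G ⥤ C} (adjG : SigmaG ⊣ GStar G)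

namespace GObj

variable {P : GObj G} {X : C} {f : P.A ⟶ X}

namespace IsInvariant

variable (hf : P.IsInvariant f)

/-- The projections `W ×_X P ⟶ W` as morphisms `Σ_G (W ×_X P) ⟶ W`. -/
def sigmaPullbackHom : (hf.toOver ⋙ Over.forget P) ⋙ SigmaG ⟶ Over.forget X where
  app W := (adjG.homEquiv (hf.pullbackObj W) W.left).symm
    (toGStar (hf.pullbackFst W) (hf.isInvariant_pullbackFst W))
  naturality {W W'} s := by
    refine (adjG.homEquiv_naturality_left_symm (hf.pullbackMap s) _).symm.trans
      (Eq.trans ?_ (adjG.homEquiv_naturality_right_symm _ s.left))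
    refine congrArg _ (gstar_hom_ext ?_)
    refine (Category.assoc _ _ _).trans (Eq.trans ?_ (Category.assoc _ _ _).symm)
    refine (congrArg (_ ≫ ·) (toGStar_snd _ _)).trans
      (Eq.trans ?_ (congrArg (_ ≫ ·) (gstar_map_snd _)).symm)
    exact (hf.pullbackMap_fst s).trans (toGStar_snd_assoc _ _ _).symm

lemma homEquiv_sigmaPullbackHom_comp (W : Over X) {Z : C} (h : W.left ⟶ Z) :
    (adjG.homEquiv (hf.pullbackObj W) Z ((hf.sigmaPullbackHom adjG).app W ≫ h)).hom ≫
      gstarSnd G Z = hf.pullbackFst W ≫ h := by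
  have e := adjG.homEquiv_naturality_right ((hf.sigmaPullbackHom adjG).app W) h
  have e' : adjG.homEquiv (hf.pullbackObj W) W.left ((hf.sigmaPullbackHom adjG).app W) =
    toGStar (hf.pullbackFst W) (hf.isInvariant_pullbackFst W) := Equiv.apply_symm_apply _ _
  refine (congrArg (fun t => GObj.Hom.hom t ≫ gstarSnd G Z) e).trans ?_
  refine (congrArg (fun t => GObj.Hom.hom (t ≫ (GStar G).map h) ≫ gstarSnd G Z) e').trans ?_
  rw [comp_hom, Category.assoc, gstar_map_snd, toGStar_snd_assoc]

instance [hf.toOver.IsEquivalence] : IsIso (hf.sigmaPullbackHom adjG) := by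
  have : ∀ W, IsIso ((hf.sigmaPullbackHom adjG).app W) := by
    intro W
    apply isIso_of_coyoneda_map_bijective
    intro Z
    constructor
    · intro h h' e
      apply hf.pullbackFst_comp_injective
      exact (hf.homEquiv_sigmaPullbackHom_comp adjG W h).symm.trans
        ((congrArg (fun t => (adjG.homEquiv (hf.pullbackObj W) Z t).hom ≫ gstarSnd G Z) e).trans
          (hf.homEquiv_sigmaPullbackHom_comp adjG W h'))
    · intro u
      let u' : SigmaG.obj (hf.pullbackObj W) ⟶ Z := u
      obtain ⟨h, hh⟩ := hf.exists_pullbackFst_comp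
        ((isInvariant_gstarSnd (G := G) Z).hom_comp (adjG.homEquiv _ _ u'))
      refine ⟨h, ?_⟩
      apply (adjG.homEquiv (hf.pullbackObj W) Z).injective
      exact gstar_hom_ext ((hf.homEquiv_sigmaPullbackHom_comp adjG W h).trans hh)
  exact NatIso.isIso_of_isIso_app _

/-- The stably Frobenius adjunction over `C` given by a principal bundle. -/
def adjunctionOver [hf.toOver.IsEquivalence] :
    StablyFrobeniusOver (Over.forget X) SigmaG where
  L := hf.toOver ⋙ Over.forget P
  R := Over.star P ⋙ hf.toOver.asEquivalence.inverse
  adj := hf.toOver.asEquivalence.toAdjunction.comp (Over.forgetAdjStar P)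
  stablyFrobenius := isStablyFrobenius_equivalence_comp_forget hf.toOver.asEquivalence
  isoOver := asIso (hf.sigmaPullbackHom adjG)

end IsInvariant

end GObj

end BundleAdjunction

section OverTerminal

variable {C : Type u} [Category.{v} C] {X : C}

/-- The canonical morphism to the terminal object of `C/X`. -/
def overToOne (W : Over X) : W ⟶ Over.mk (𝟙 X) :=
  Over.homMk W.hom (Category.comp_id _)

lemma overToOne_unique {W : Over X} (t t' : W ⟶ Over.mk (𝟙 X)) : t = t' := by
  apply Over.OverMorphism.ext
  exact (Category.comp_id _).symm.trans ((Over.w t).trans ((Over.w t').symm.trans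
    (Category.comp_id _)))

end OverTerminal

section BundleFunctor

variable {C : Type u} [Category.{v} C] [HasFiniteLimits C] {G : InternalGroupoid C}
  {SigmaG : GObj G ⥤ C} (adjG : SigmaG ⊣ GStar G)

namespace GObj.IsInvariant

variable {P P' : GObj G} {X : C} {f : P.A ⟶ X} {f' : P'.A ⟶ X} (hf : P.IsInvariant f)
  (hf' : P'.IsInvariant f')

/-- The morphism `W ×_X P ⟶ W ×_X P'` induced by an equivariant morphism over `X`. -/
def pullbackBundleMap (u : P ⟶ P') (hu : u.hom ≫ f' = f) (W : Over X) :
    hf.pullbackObj W ⟶ hf'.pullbackObj W :=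
  hf'.pullbackLift W (hf.pullbackFst W) (hf.isInvariant_pullbackFst W)
    (hf.pullbackSnd W ≫ u) (by rw [comp_hom, Category.assoc, hu, (hf.isPullback W).w])

@[simp]
lemma pullbackBundleMap_fst (u : P ⟶ P') (hu : u.hom ≫ f' = f) (W : Over X) :
    (hf.pullbackBundleMap hf' u hu W).hom ≫ hf'.pullbackFst W = hf.pullbackFst W :=
  hf'.pullbackLift_fst _ _ _ _ _

@[simp]
lemma pullbackBundleMap_snd (u : P ⟶ P') (hu : u.hom ≫ f' = f) (W : Over X) :
    hf.pullbackBundleMap hf' u hu W ≫ hf'.pullbackSnd W = hf.pullbackSnd W ≫ u :=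
  hf'.pullbackLift_snd _ _ _ _ _

@[simp]
lemma pullbackBundleMap_fst_assoc (u : P ⟶ P') (hu : u.hom ≫ f' = f) (W : Over X) {Z : C}
    (h : W.left ⟶ Z) :
    (hf.pullbackBundleMap hf' u hu W).hom ≫ hf'.pullbackFst W ≫ h = hf.pullbackFst W ≫ h := by
  rw [← Category.assoc, pullbackBundleMap_fst]

@[simp]
lemma pullbackBundleMap_snd_assoc (u : P ⟶ P') (hu : u.hom ≫ f' = f) (W : Over X) {Z : GObj G}
    (h : P' ⟶ Z) :
    hf.pullbackBundleMap hf' u hu W ≫ hf'.pullbackSnd W ≫ h = hf.pullbackSnd W ≫ u ≫ h := by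
  rw [← Category.assoc, pullbackBundleMap_snd, Category.assoc]

/-- The transformation `W ×_X P ⟶ W ×_X P'` induced by an equivariant morphism over `X`. -/
def mapBundle (u : P ⟶ P') (hu : u.hom ≫ f' = f) :
    hf.toOver ⋙ Over.forget P ⟶ hf'.toOver ⋙ Over.forget P' where
  app W := hf.pullbackBundleMap hf' u hu W
  naturality {W W'} s := by
    have h : hf.pullbackMap s ≫ hf.pullbackBundleMap hf' u hu W' =
        hf.pullbackBundleMap hf' u hu W ≫ hf'.pullbackMap s :=
      hf'.pullbackObj_hom_ext (by simp) (by simp)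
    exact h

lemma mapBundle_id : hf.mapBundle hf (𝟙 P) (Category.id_comp f) = 𝟙 _ := by
  ext W : 2
  refine hf.pullbackObj_hom_ext (u := hf.pullbackBundleMap hf (𝟙 P) (Category.id_comp f) W)
    (u' := 𝟙 (hf.pullbackObj W)) ?_ ?_ <;> simp

lemma mapBundle_comp {P'' : GObj G} {f'' : P''.A ⟶ X} (hf'' : P''.IsInvariant f'') {u : P ⟶ P'}
    {u' : P' ⟶ P''} (hu : u.hom ≫ f' = f) (hu' : u'.hom ≫ f'' = f') :
    hf.mapBundle hf'' (u ≫ u') (by rw [comp_hom, Category.assoc, hu', hu]) =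
      hf.mapBundle hf' u hu ≫ hf'.mapBundle hf'' u' hu' := by
  ext W : 2
  refine hf''.pullbackObj_hom_ext
    (u := hf.pullbackBundleMap hf'' (u ≫ u') (by rw [comp_hom, Category.assoc, hu', hu]) W)
    (u' := hf.pullbackBundleMap hf' u hu W ≫ hf'.pullbackBundleMap hf'' u' hu' W) ?_ ?_ <;> simp

/-- The section `P ⟶ X ×_X P`. -/
def toPullbackOne : P ⟶ hf.pullbackObj (Over.mk (𝟙 X)) :=
  hf.pullbackLift (Over.mk (𝟙 X)) f hf (𝟙 P) (by
    rw [id_hom, Category.id_comp]; exact Category.comp_id f)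

lemma toPullbackOne_snd : hf.toPullbackOne ≫ hf.pullbackSnd (Over.mk (𝟙 X)) = 𝟙 P :=
  hf.pullbackLift_snd _ _ hf _ _

lemma toPullbackOne_fst : hf.toPullbackOne.hom ≫ hf.pullbackFst (Over.mk (𝟙 X)) = f :=
  hf.pullbackLift_fst _ _ hf _ _

lemma pullbackSnd_toPullbackOne :
    hf.pullbackSnd (Over.mk (𝟙 X)) ≫ hf.toPullbackOne = 𝟙 _ := by
  apply hf.pullbackObj_hom_ext
  · rw [comp_hom, Category.assoc, toPullbackOne_fst, id_hom, Category.id_comp,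
      ← (hf.isPullback _).w]
    exact Category.comp_id _
  · rw [Category.assoc, toPullbackOne_snd, Category.comp_id, Category.id_comp]

variable (α : hf.toOver ⋙ Over.forget P ⟶ hf'.toOver ⋙ Over.forget P')

/-- A transformation between the functors given by two bundles, at the terminal object of
`C/X`. -/
def bundleHomOfNatTrans : P ⟶ P' :=
  hf.toPullbackOne ≫ α.app (Over.mk (𝟙 X)) ≫ hf'.pullbackSnd (Over.mk (𝟙 X))

lemma natTrans_app_snd (W : Over X) :
    α.app W ≫ hf'.pullbackSnd W = hf.pullbackSnd W ≫ bundleHomOfNatTrans hf hf' α := by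
  let α₁ : hf.pullbackObj (Over.mk (𝟙 X)) ⟶ hf'.pullbackObj (Over.mk (𝟙 X)) := α.app _
  let αW : hf.pullbackObj W ⟶ hf'.pullbackObj W := α.app W
  have hα : hf.pullbackMap (overToOne W) ≫ α₁ = αW ≫ hf'.pullbackMap (overToOne W) :=
    α.naturality (overToOne W)
  change αW ≫ _ = _ ≫ hf.toPullbackOne ≫ α₁ ≫ hf'.pullbackSnd _
  have h₁ := hf'.pullbackMap_snd (overToOne W)
  have h₂ := hf.pullbackMap_snd (overToOne W)
  have h₃ := hf.pullbackSnd_toPullbackOne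
  rw [← h₁, ← Category.assoc αW, ← hα, ← h₂, Category.assoc, Category.assoc,
    ← Category.assoc _ hf.toPullbackOne, h₃, Category.id_comp]

lemma natTrans_app_one_fst
    (hα : ∀ W, ((α.app W : hf.pullbackObj W ⟶ hf'.pullbackObj W)).hom ≫ hf'.pullbackFst W =
      hf.pullbackFst W) :
    (bundleHomOfNatTrans hf hf' α).hom ≫ f' = f := by
  let α₁ : hf.pullbackObj (Over.mk (𝟙 X)) ⟶ hf'.pullbackObj (Over.mk (𝟙 X)) := α.app _
  have h : α₁.hom ≫ hf'.pullbackFst (Over.mk (𝟙 X)) = hf.pullbackFst (Over.mk (𝟙 X)) := hα _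
  have h' : hf'.pullbackFst (Over.mk (𝟙 X)) = (hf'.pullbackSnd (Over.mk (𝟙 X))).hom ≫ f' :=
    (Category.comp_id _).symm.trans (hf'.isPullback (Over.mk (𝟙 X))).w
  change (hf.toPullbackOne ≫ α₁ ≫ hf'.pullbackSnd _).hom ≫ f' = f
  rw [comp_hom, comp_hom, Category.assoc, Category.assoc]
  refine (congrArg (fun t => hf.toPullbackOne.hom ≫ α₁.hom ≫ t) h').symm.trans ?_
  exact (congrArg (fun t => hf.toPullbackOne.hom ≫ t) h).trans hf.toPullbackOne_fst

/-- A transformation between the functors given by two bundles is compatible with the projections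
to `C/X` if and only if it is over `C`. -/
lemma whiskerRight_comp_sigmaPullbackHom_iff :
    Functor.whiskerRight α SigmaG ≫ hf'.sigmaPullbackHom adjG = hf.sigmaPullbackHom adjG ↔
      ∀ W, ((α.app W : hf.pullbackObj W ⟶ hf'.pullbackObj W)).hom ≫ hf'.pullbackFst W =
        hf.pullbackFst W := by
  have key : ∀ W, (Functor.whiskerRight α SigmaG ≫ hf'.sigmaPullbackHom adjG).app W =
      (adjG.homEquiv (hf.pullbackObj W) W.left).symm
        ((α.app W : hf.pullbackObj W ⟶ hf'.pullbackObj W) ≫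
          toGStar (hf'.pullbackFst W) (hf'.isInvariant_pullbackFst W)) := fun W =>
    (adjG.homEquiv_naturality_left_symm (α.app W : hf.pullbackObj W ⟶ hf'.pullbackObj W) _).symm
  constructor
  · intro h W
    have h₁ := (adjG.homEquiv (hf.pullbackObj W) W.left).symm.injective
      ((key W).symm.trans (congrArg (fun t => t.app W) h))
    have h₂ := congrArg (fun t => GObj.Hom.hom t ≫ gstarSnd G W.left) h₁
    exact (congrArg (_ ≫ ·) (toGStar_snd _ _)).symm.trans ((Category.assoc _ _ _).symm.trans
      (h₂.trans (toGStar_snd _ _)))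
  · intro h
    ext W
    refine (key W).trans (congrArg _ (gstar_hom_ext ?_))
    exact (Category.assoc _ _ _).trans ((congrArg (_ ≫ ·) (toGStar_snd _ _)).trans
      ((h W).trans (toGStar_snd _ _).symm))

end GObj.IsInvariant

namespace PrincipalBundle

variable {X : C} (B : PrincipalBundle G X)

lemma isInvariant_f : B.P.IsInvariant B.f := B.act_f

lemma isPullback_act : IsPullback B.P.act (pullback.snd G.d₀ B.P.g) B.f B.f := by
  have := B.isIso
  exact IsPullback.of_iso_pullback ⟨B.act_f⟩
    (asIso (pullback.lift B.P.act (pullback.snd G.d₀ B.P.g) B.act_f))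
    (pullback.lift_fst _ _ _) (pullback.lift_snd _ _ _)

instance : B.isInvariant_f.toOver.IsEquivalence :=
  (GObj.isEquivalence_toOver_iff B.isPullback_act).2 B.descent

/-- The principal bundle given by an equivalence of `C/X` with the `G`-objects over `P`. -/
def ofIsEquivalence {P : GObj G} {f : P.A ⟶ X} (hf : P.IsInvariant f)
    [hf.toOver.IsEquivalence] : PrincipalBundle G X where
  P := P
  f := f
  act_f := hf
  descent := (GObj.isEquivalence_toOver_iff hf.isPullback_act).1 inferInstance
  isIso := by
    have h := hf.isPullback_act
    have e : pullback.lift P.act (pullback.snd G.d₀ P.g) hf = h.isoPullback.hom := by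
      apply pullback.hom_ext
      · exact (pullback.lift_fst _ _ _).trans h.isoPullback_hom_fst.symm
      · exact (pullback.lift_snd _ _ _).trans h.isoPullback_hom_snd.symm
    rw [e]
    exact h.isoPullback.isIso_hom

/-- The functor from principal bundles to stably Frobenius adjunctions over `C`. -/
def toAdjunctionOver (X : C) :
    PrincipalBundle G X ⥤ StablyFrobeniusOver (Over.forget X) SigmaG where
  obj B := B.isInvariant_f.adjunctionOver adjG
  map {B B'} u :=
    { nat := B.isInvariant_f.mapBundle B'.isInvariant_f u.hom u.hom_f
      w := (B.isInvariant_f.whiskerRight_comp_sigmaPullbackHom_iff adjG B'.isInvariant_f _).2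
        (B.isInvariant_f.pullbackBundleMap_fst B'.isInvariant_f u.hom u.hom_f) }
  map_id B := StablyFrobeniusOver.Hom.ext B.isInvariant_f.mapBundle_id
  map_comp {B B' B''} u u' := StablyFrobeniusOver.Hom.ext
    (B.isInvariant_f.mapBundle_comp B'.isInvariant_f B''.isInvariant_f u.hom_f u'.hom_f)

lemma toAdjunctionOver_full : (toAdjunctionOver adjG X).Full where
  map_surjective {B B'} α := by
    let hf := B.isInvariant_f
    let hf' := B'.isInvariant_f
    let a : hf.toOver ⋙ Over.forget B.P ⟶ hf'.toOver ⋙ Over.forget B'.P := α.nat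
    have ha := (hf.whiskerRight_comp_sigmaPullbackHom_iff adjG hf' a).1 α.w
    have hu := hf.natTrans_app_one_fst hf' a ha
    refine ⟨{ hom := hf.bundleHomOfNatTrans hf' a, hom_f := hu }, ?_⟩
    apply StablyFrobeniusOver.Hom.ext
    ext W : 2
    refine hf'.pullbackObj_hom_ext (u := hf.pullbackBundleMap hf' _ hu W) (u' := a.app W) ?_ ?_
    · exact (hf.pullbackBundleMap_fst hf' _ hu W).trans (ha W).symm
    · exact (hf.pullbackBundleMap_snd hf' _ hu W).trans (hf.natTrans_app_snd hf' a W).symm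

lemma toAdjunctionOver_faithful : (toAdjunctionOver adjG X).Faithful where
  map_injective {B B'} u u' h := by
    apply PrincipalBundle.Hom.ext
    let hf := B.isInvariant_f
    let hf' := B'.isInvariant_f
    have e : ∀ t : B ⟶ B', hf.toPullbackOne ≫
        (hf.mapBundle hf' t.hom t.hom_f).app (Over.mk (𝟙 X)) ≫
          hf'.pullbackSnd (Over.mk (𝟙 X)) = t.hom := fun t => by
      refine (congrArg (_ ≫ ·) (hf.pullbackBundleMap_snd hf' t.hom t.hom_f _)).trans ?_
      rw [← Category.assoc, GObj.IsInvariant.toPullbackOne_snd, Category.id_comp]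
    have h' : hf.mapBundle hf' u.hom u.hom_f = hf.mapBundle hf' u'.hom u'.hom_f :=
      congrArg (fun t => t.nat) h
    rw [← e u, ← e u', h']

end PrincipalBundle

end BundleFunctor

section Reconstruction

variable {C : Type u} [Category.{v} C] [HasFiniteLimits C] {G : InternalGroupoid C}
  {SigmaG : GObj G ⥤ C} (adjG : SigmaG ⊣ GStar G) {X : C}

namespace GObj.IsInvariant

variable {P : GObj G} {f : P.A ⟶ X} (hf : P.IsInvariant f)

lemma toOver_faithful (h₁ : ∀ (W : Over X) {Z : C} {h h' : W.left ⟶ Z},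
    hf.pullbackFst W ≫ h = hf.pullbackFst W ≫ h' → h = h') : hf.toOver.Faithful where
  map_injective {W W'} s s' e := by
    apply Over.OverMorphism.ext
    apply h₁ W
    exact (hf.pullbackMap_fst s).symm.trans
      ((congrArg (fun t => t.left.hom ≫ hf.pullbackFst W') e).trans (hf.pullbackMap_fst s'))

lemma toOver_full (h₁ : ∀ (W : Over X) {Z : C} {h h' : W.left ⟶ Z},
      hf.pullbackFst W ≫ h = hf.pullbackFst W ≫ h' → h = h')
    (h₂ : ∀ (W : Over X) {Z : C} (c : (hf.pullbackObj W).A ⟶ Z),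
      (hf.pullbackObj W).IsInvariant c → ∃ h, hf.pullbackFst W ≫ h = c) : hf.toOver.Full where
  map_surjective {W W'} θ := by
    let t : hf.pullbackObj W ⟶ hf.pullbackObj W' := θ.left
    have ht : t ≫ hf.pullbackSnd W' = hf.pullbackSnd W := Over.w θ
    obtain ⟨h, hh⟩ := h₂ W _ ((hf.isInvariant_pullbackFst W').hom_comp t)
    have hX : h ≫ W'.hom = W.hom := by
      apply h₁ W
      rw [← Category.assoc, hh, Category.assoc, (hf.isPullback W').w, (hf.isPullback W).w, ← ht,
        comp_hom, Category.assoc]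
    refine ⟨Over.homMk h hX, Over.OverMorphism.ext ?_⟩
    refine hf.pullbackObj_hom_ext (u := hf.pullbackMap (Over.homMk h hX)) (u' := t) ?_ ?_
    · exact (hf.pullbackMap_fst _).trans hh
    · exact (hf.pullbackMap_snd _).trans ht.symm

end GObj.IsInvariant

namespace StablyFrobeniusOver

variable (F : StablyFrobeniusOver (Over.forget X) SigmaG)

/-- The morphism `L W ⟶ G^* W` corresponding to `Σ_G (L W) ≅ W`. -/
def toStar (W : Over X) : F.L.obj W ⟶ (GStar G).obj W.left :=
  adjG.homEquiv (F.L.obj W) W.left (F.isoOver.hom.app W)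

lemma map_toStar {W W' : Over X} (s : W ⟶ W') :
    F.L.map s ≫ F.toStar adjG W' = F.toStar adjG W ≫ (GStar G).map s.left := by
  refine (adjG.homEquiv_naturality_left (F.L.map s) (F.isoOver.hom.app W')).symm.trans
    (Eq.trans ?_ (adjG.homEquiv_naturality_right (F.isoOver.hom.app W) s.left))
  exact congrArg _ (F.isoOver.hom.naturality s)

lemma toStar_comp_bijective (W : Over X) (Z : C) :
    Function.Bijective (fun h : W.left ⟶ Z => F.toStar adjG W ≫ (GStar G).map h) := by
  have e : (fun h : W.left ⟶ Z => F.toStar adjG W ≫ (GStar G).map h) =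
      fun h => ((F.isoOver.app W).homFromEquiv.symm.trans (adjG.homEquiv (F.L.obj W) Z)) h := by
    funext h
    exact (adjG.homEquiv_naturality_right (F.isoOver.hom.app W) h).symm
  rw [e]
  exact Equiv.bijective _

/-- The invariant morphism `L W ⟶ W`. -/
def proj (W : Over X) : (F.L.obj W).A ⟶ W.left :=
  (F.toStar adjG W).hom ≫ GObj.gstarSnd G W.left

lemma isInvariant_proj (W : Over X) : (F.L.obj W).IsInvariant (F.proj adjG W) :=
  (GObj.isInvariant_gstarSnd W.left).hom_comp _

lemma toStar_comp_snd (W : Over X) {Z : C} (h : W.left ⟶ Z) :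
    (F.toStar adjG W ≫ (GStar G).map h).hom ≫ GObj.gstarSnd G Z = F.proj adjG W ≫ h := by
  rw [GObj.comp_hom, Category.assoc, GObj.gstar_map_snd, proj, Category.assoc]

lemma proj_comp_injective (W : Over X) {Z : C} {h h' : W.left ⟶ Z}
    (e : F.proj adjG W ≫ h = F.proj adjG W ≫ h') : h = h' := by
  apply (F.toStar_comp_bijective adjG W Z).1
  apply GObj.gstar_hom_ext
  rw [toStar_comp_snd, toStar_comp_snd, e]

lemma exists_proj_comp (W : Over X) {Z : C} {c : (F.L.obj W).A ⟶ Z}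
    (hc : (F.L.obj W).IsInvariant c) : ∃ h : W.left ⟶ Z, F.proj adjG W ≫ h = c := by
  obtain ⟨h, hh⟩ := (F.toStar_comp_bijective adjG W Z).2 (GObj.toGStar c hc)
  refine ⟨h, ?_⟩
  rw [← toStar_comp_snd, ← GObj.toGStar_snd c hc, ← hh]

lemma map_proj {W W' : Over X} (s : W ⟶ W') :
    (F.L.map s).hom ≫ F.proj adjG W' = F.proj adjG W ≫ s.left := by
  rw [← toStar_comp_snd, ← map_toStar, GObj.comp_hom, Category.assoc, proj]

/-- The `G`-object of the principal bundle of an adjunction over `C`. -/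
abbrev total : GObj G := F.L.obj (Over.mk (𝟙 X))

/-- The projection of the principal bundle of an adjunction over `C`. -/
def projOne : F.total.A ⟶ X := F.proj adjG (Over.mk (𝟙 X))

lemma isInvariant_projOne : F.total.IsInvariant (F.projOne adjG) := F.isInvariant_proj adjG _

lemma isPullback_homEquiv_toStar (W : Over X) :
    IsPullback (F.adj.homEquiv W _ (F.toStar adjG W)) (overToOne W)
      (F.R.map ((GStar G).map W.hom))
      (F.adj.homEquiv (Over.mk (𝟙 X)) ((GStar G).obj X) (F.toStar adjG (Over.mk (𝟙 X)))) := by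
  have h₁ : ∀ {T : Over X} (t : T ⟶ W), t ≫ F.adj.homEquiv W _ (F.toStar adjG W) =
      F.adj.homEquiv T _ (F.toStar adjG T ≫ (GStar G).map t.left) := fun t => by
    rw [← map_toStar, Adjunction.homEquiv_naturality_left]
  have h₂ : ∀ {T : Over X} (t : T ⟶ Over.mk (𝟙 X)),
      t ≫ F.adj.homEquiv (Over.mk (𝟙 X)) ((GStar G).obj X) (F.toStar adjG (Over.mk (𝟙 X))) =
        F.adj.homEquiv T _ (F.toStar adjG T ≫ (GStar G).map T.hom) := fun {T} t => by
    have e : F.L.map t ≫ F.toStar adjG (Over.mk (𝟙 X)) = F.toStar adjG T ≫ (GStar G).map T.hom := by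
      rw [overToOne_unique t (overToOne T)]
      exact F.map_toStar adjG (overToOne T)
    exact (F.adj.homEquiv_naturality_left t _).symm.trans (congrArg _ e)
  have h₃ : ∀ {T : Over X} (h : T.left ⟶ W.left),
      F.adj.homEquiv T _ (F.toStar adjG T ≫ (GStar G).map h) ≫ F.R.map ((GStar G).map W.hom) =
        F.adj.homEquiv T _ (F.toStar adjG T ≫ (GStar G).map (h ≫ W.hom)) := fun h => by
    rw [← Adjunction.homEquiv_naturality_right, Functor.map_comp, Category.assoc]
  have h₄ : ∀ (s : PullbackCone (F.R.map ((GStar G).map W.hom))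
      (F.adj.homEquiv (Over.mk (𝟙 X)) ((GStar G).obj X) (F.toStar adjG (Over.mk (𝟙 X))))),
      ∃ t : s.pt ⟶ W, t ≫ F.adj.homEquiv W _ (F.toStar adjG W) = s.fst := fun s => by
    obtain ⟨h, hh⟩ := (F.toStar_comp_bijective adjG s.pt W.left).2 ((F.adj.homEquiv _ _).symm s.fst)
    have hh' : F.adj.homEquiv s.pt _ (F.toStar adjG s.pt ≫ (GStar G).map h) = s.fst :=
      (Equiv.eq_symm_apply _).1 hh
    have hX : h ≫ W.hom = s.pt.hom := by
      apply (F.toStar_comp_bijective adjG s.pt X).1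
      apply (F.adj.homEquiv s.pt _).injective
      refine (h₃ h).symm.trans (Eq.trans ?_ (h₂ s.snd))
      rw [hh']
      exact s.condition
    exact ⟨Over.homMk h hX, (h₁ _).trans hh'⟩
  refine ⟨⟨?_⟩, ⟨PullbackCone.IsLimit.mk _ (fun s => (h₄ s).choose) (fun s => (h₄ s).choose_spec)
    (fun _ => overToOne_unique _ _) (fun s m hm _ => ?_)⟩⟩
  · have e := h₁ (𝟙 W)
    rw [Category.id_comp] at e
    rw [e, h₃, h₂]
    exact congrArg (fun t => F.adj.homEquiv W _ (F.toStar adjG W ≫ (GStar G).map t))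
      (Category.id_comp W.hom)
  · apply Over.OverMorphism.ext
    apply (F.toStar_comp_bijective adjG s.pt W.left).1
    apply (F.adj.homEquiv s.pt _).injective
    exact (h₁ m).symm.trans (hm.trans ((h₄ s).choose_spec.symm.trans (h₁ _)))

lemma isPullback_toStar (W : Over X) :
    IsPullback (F.toStar adjG W) (F.L.map (overToOne W)) ((GStar G).map W.hom)
      (F.toStar adjG (Over.mk (𝟙 X)) : F.total ⟶ (GStar G).obj X) := by
  have h := (isStablyFrobenius_iff F.adj).1 F.stablyFrobenius _ _ _ _
    (F.isPullback_homEquiv_toStar adjG W)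
  have e : ∀ {T : Over X} {Y : GObj G} (g : F.L.obj T ⟶ Y),
      F.L.map (F.adj.homEquiv T Y g) ≫ F.adj.counit.app Y = g := fun g =>
    (F.adj.homEquiv_counit _ _ _).symm.trans (Equiv.symm_apply_apply _ g)
  have key : ∀ {p : F.L.obj W ⟶ (GStar G).obj W.left} {q : F.total ⟶ (GStar G).obj X},
      p = F.toStar adjG W → q = F.toStar adjG (Over.mk (𝟙 X)) →
        IsPullback p (F.L.map (overToOne W)) ((GStar G).map W.hom) q →
          IsPullback (F.toStar adjG W) (F.L.map (overToOne W)) ((GStar G).map W.hom)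
            (F.toStar adjG (Over.mk (𝟙 X)) : F.total ⟶ (GStar G).obj X) := by
    rintro _ _ rfl rfl h'
    exact h'
  exact key (e _) (e _) h

lemma isPullback_proj (W : Over X) :
    IsPullback (F.proj adjG W) (F.L.map (overToOne W)).hom W.hom (F.projOne adjG) :=
  (GObj.isPullback_hom (F.isPullback_toStar adjG W)).paste_horiz
    (GObj.isPullback_gstar (G := G) W.hom).flip

/-- The comparison `L W ⟶ W ×_X P`. -/
def toPullbackObj (W : Over X) : F.L.obj W ⟶ (F.isInvariant_projOne adjG).pullbackObj W :=
  (F.isInvariant_projOne adjG).pullbackLift W (F.proj adjG W) (F.isInvariant_proj adjG W)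
    (F.L.map (overToOne W)) (F.isPullback_proj adjG W).w

lemma toPullbackObj_fst (W : Over X) :
    (F.toPullbackObj adjG W).hom ≫ (F.isInvariant_projOne adjG).pullbackFst W = F.proj adjG W :=
  GObj.IsInvariant.pullbackLift_fst _ _ _ _ _ _

lemma toPullbackObj_snd (W : Over X) :
    F.toPullbackObj adjG W ≫ (F.isInvariant_projOne adjG).pullbackSnd W =
      F.L.map (overToOne W) :=
  GObj.IsInvariant.pullbackLift_snd _ _ _ (F.isInvariant_proj adjG W) _ _

instance (W : Over X) : IsIso (F.toPullbackObj adjG W) := by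
  apply GObj.isIso_of_isIso_hom
  have h := (F.isInvariant_projOne adjG).isPullback W
  have e : (F.toPullbackObj adjG W).hom = ((F.isPullback_proj adjG W).isoIsPullback _ _ h).hom := by
    apply h.hom_ext
    · rw [toPullbackObj_fst, IsPullback.isoIsPullback_hom_fst]
    · rw [← GObj.comp_hom, toPullbackObj_snd, IsPullback.isoIsPullback_hom_snd]
  rw [e]
  infer_instance

lemma toPullbackObj_naturality {W W' : Over X} (s : W ⟶ W') :
    F.L.map s ≫ F.toPullbackObj adjG W' =
      F.toPullbackObj adjG W ≫ (F.isInvariant_projOne adjG).pullbackMap s := by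
  apply GObj.IsInvariant.pullbackObj_hom_ext
  · rw [GObj.comp_hom, GObj.comp_hom, Category.assoc, Category.assoc, toPullbackObj_fst,
      GObj.IsInvariant.pullbackMap_fst, ← Category.assoc, toPullbackObj_fst, map_proj]
  · rw [Category.assoc, Category.assoc, toPullbackObj_snd, GObj.IsInvariant.pullbackMap_snd,
      toPullbackObj_snd, ← F.L.map_comp, overToOne_unique (s ≫ overToOne W') (overToOne W)]

lemma pullbackFst_comp_injective (W : Over X) {Z : C} {h h' : W.left ⟶ Z}
    (e : (F.isInvariant_projOne adjG).pullbackFst W ≫ h =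
      (F.isInvariant_projOne adjG).pullbackFst W ≫ h') : h = h' := by
  apply F.proj_comp_injective adjG W
  rw [← toPullbackObj_fst, Category.assoc, e, Category.assoc]

lemma exists_pullbackFst_comp (W : Over X) {Z : C}
    (c : ((F.isInvariant_projOne adjG).pullbackObj W).A ⟶ Z)
    (hc : ((F.isInvariant_projOne adjG).pullbackObj W).IsInvariant c) :
    ∃ h, (F.isInvariant_projOne adjG).pullbackFst W ≫ h = c := by
  obtain ⟨h, hh⟩ := F.exists_proj_comp adjG W (hc.hom_comp (F.toPullbackObj adjG W))
  refine ⟨h, ?_⟩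
  rw [← toPullbackObj_fst, Category.assoc] at hh
  have h₁ := congrArg (fun t => (inv (F.toPullbackObj adjG W)).hom ≫ t) hh
  have h₂ : (inv (F.toPullbackObj adjG W)).hom ≫ (F.toPullbackObj adjG W).hom = 𝟙 _ := by
    rw [← GObj.comp_hom, IsIso.inv_hom_id, GObj.id_hom]
  simpa only [← Category.assoc, h₂, Category.id_comp] using h₁

lemma exists_toOver_iso (Q : Over F.total) :
    ∃ Y : Over X, Nonempty ((F.isInvariant_projOne adjG).toOver.obj Y ≅ Q) := by
  let u : Over.mk (𝟙 X) ⟶ F.R.obj F.total := F.adj.unit.app (Over.mk (𝟙 X))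
  let Y := pullback (F.R.map Q.hom) u
  let a : F.L.obj Y ⟶ Q.left :=
    F.L.map (pullback.fst (F.R.map Q.hom) u) ≫ F.adj.counit.app Q.left
  have hu : F.L.map u ≫ F.adj.counit.app F.total = 𝟙 F.total :=
    F.adj.left_triangle_components _
  have sq : IsPullback a (F.L.map (pullback.snd (F.R.map Q.hom) u)) Q.hom
      (F.L.map u ≫ F.adj.counit.app F.total) :=
    (isStablyFrobenius_iff F.adj).1 F.stablyFrobenius _ _ _ _ (IsPullback.of_hasPullback _ _)
  have sq' : IsPullback a (F.L.map (overToOne Y)) Q.hom (𝟙 F.total) := by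
    convert sq using 1
    · exact congrArg F.L.map (overToOne_unique _ _)
    · exact hu.symm
  have ha : IsIso a := sq'.isIso_fst_of_isIso
  refine ⟨Y, ⟨Over.isoMk ((asIso (F.toPullbackObj adjG Y)).symm ≪≫ asIso a) ?_⟩⟩
  change (inv (F.toPullbackObj adjG Y) ≫ a) ≫ Q.hom = (F.isInvariant_projOne adjG).pullbackSnd Y
  rw [Category.assoc, IsIso.inv_comp_eq, toPullbackObj_snd, sq'.w, Category.comp_id]

instance : (F.isInvariant_projOne adjG).toOver.IsEquivalence where
  faithful := GObj.IsInvariant.toOver_faithful _ fun W _ _ _ => F.pullbackFst_comp_injective adjG W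
  full := GObj.IsInvariant.toOver_full _ (fun W _ _ _ => F.pullbackFst_comp_injective adjG W)
    fun W _ => F.exists_pullbackFst_comp adjG W
  essSurj := ⟨F.exists_toOver_iso adjG⟩

/-- The comparison between an adjunction over `C` and the one given by its principal bundle. -/
def toPullbackNatIso : F.L ≅ (F.isInvariant_projOne adjG).toOver ⋙ Over.forget F.total :=
  NatIso.ofComponents (fun W =>
      let e : F.L.obj W ≅ (F.isInvariant_projOne adjG).pullbackObj W :=
        asIso (F.toPullbackObj adjG W)
      e)
    fun s => F.toPullbackObj_naturality adjG s

lemma whiskerRight_toPullbackNatIso :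
    Functor.whiskerRight (F.toPullbackNatIso adjG).hom SigmaG ≫
      (F.isInvariant_projOne adjG).sigmaPullbackHom adjG = F.isoOver.hom := by
  ext W
  refine (adjG.homEquiv_naturality_left_symm (F.toPullbackObj adjG W) _).symm.trans ?_
  refine Eq.trans (congrArg _ (GObj.gstar_hom_ext ?_)) (Equiv.symm_apply_apply
    (adjG.homEquiv (F.L.obj W) W.left) (F.isoOver.hom.app W))
  exact (Category.assoc _ _ _).trans ((congrArg (_ ≫ ·) (GObj.toGStar_snd _ _)).trans
    (F.toPullbackObj_fst adjG W))

/-- An adjunction over `C` is isomorphic to the one given by its principal bundle. -/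
def isoAdjunctionOver : F ≅ (F.isInvariant_projOne adjG).adjunctionOver adjG where
  hom := { nat := (F.toPullbackNatIso adjG).hom
           w := F.whiskerRight_toPullbackNatIso adjG }
  inv := { nat := (F.toPullbackNatIso adjG).inv
           w := (Iso.inv_comp_eq (Functor.isoWhiskerRight (F.toPullbackNatIso adjG) SigmaG)).2
             (F.whiskerRight_toPullbackNatIso adjG).symm }
  hom_inv_id := StablyFrobeniusOver.Hom.ext (Iso.hom_inv_id _)
  inv_hom_id := StablyFrobeniusOver.Hom.ext (Iso.inv_hom_id _)

end StablyFrobeniusOver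

lemma PrincipalBundle.toAdjunctionOver_isEquivalence (X : C) :
    (PrincipalBundle.toAdjunctionOver adjG X).IsEquivalence where
  faithful := PrincipalBundle.toAdjunctionOver_faithful adjG
  full := PrincipalBundle.toAdjunctionOver_full adjG
  essSurj := ⟨fun F => ⟨PrincipalBundle.ofIsEquivalence (F.isInvariant_projOne adjG),
    ⟨(F.isoAdjunctionOver adjG).symm⟩⟩⟩

end Reconstruction

end FrobBundle

end

theorem mainTheorem3 {C : Type u} [Category.{v} C] [HasFiniteLimits C]
    (G : FrobBundle.InternalGroupoid C)
    (SigmaG : FrobBundle.GObj G ⥤ C) (adjG : SigmaG ⊣ FrobBundle.GStar G)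
    (hG : FrobBundle.IsStablyFrobenius adjG) (X : C) :
    Nonempty (FrobBundle.PrincipalBundle G X ≌
      FrobBundle.StablyFrobeniusOver (Over.forget X) SigmaG) :=
  have := FrobBundle.PrincipalBundle.toAdjunctionOver_isEquivalence adjG X
  ⟨(FrobBundle.PrincipalBundle.toAdjunctionOver adjG X).asEquivalence⟩
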